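/- For a prime $p$, $n\in\mathbb N$ and $r\in\mathbb Z$ let $$F_p(n,r)=(-p)^{-\lfloor (n-1)/(p-1)\rfloor}\sum_{\substack{0\le k\le n\\ k\equiv r\ (\mathrm{mod}\ p)}}\binom nk(-1)^k+[\![n=0]\!]$$ be the Fleck quotient, where $[\![n=0]\!]$ is $1$ if $n=0$ and $0$ otherwise. Let $n_*\in\{1,\dots,p-1\}$ be the smallest positive residue of $n$ modulo $p-1$, $B_k$ the $k$-th Bernoulli number, $S(N,k)$ the Stirling number of the second kind, $\varphi$ Euler's totient function, and $\mathrm{ord}_p$ the $p$-adic valuation. For rational numbers, $x\equiv y\pmod p$ means that $x$ and $y$ are $p$-adic integers and $x-y\in p\mathbb Z_p$. **Theorem 1.2.** Let $p$ be an odd prime and let $n$ be a positive integer with $2\mid n$ and $p-1\nmid n$. Then $$\frac{2\sum_{k=1}^n\binom{pn-1}{pk-1}(-1)^k}{(-p)^{\lfloor(n-2)/(p-1)\rfloor}\,p^{n+1}\,n}=\frac{F_p(pn,0)}{pn}\equiv\frac{n_*!}{n_*+1}B_{p-1-n_*}\pmod p.$$ Moreover, for all positive integers $b,m$ with $b>2\lfloor(pn-1)/(p-1)\rfloor$,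 $$\frac2{pn}\cdot\frac{(pn-1)!\,S(m\varphi(p^b),pn-1)}{(-p)^{\lfloor(pn-2)/(p-1)\rfloor}}\equiv-\frac{(pn-1)!\,S(m\varphi(p^b),pn)}{(-p)^{\lfloor(pn-1)/(p-1)\rfloor}}\equiv\frac{n_*!}{n_*+1}B_{p-1-n_*}\pmod p.$$ Furthermore, the conjecture of Gessel and Lengyel that for all such $p,n$ (with $m>0$ and $b$ as above) $$\mathrm{ord}_p\big((pn-1)!\,S(m\varphi(p^b),pn-1)\big)=\Big\lfloor\frac{pn-2}{p-1}\Big\rfloor+\mathrm{ord}_p(pn),\qquad \mathrm{ord}_p\big((pn)!\,S(m\varphi(p^b),pn)\big)=\Big\lfloor\frac{pn-1}{p-1}\Big\rfloor+\mathrm{ord}_p(pn)$$ is false: there are an odd prime $p$ and a positive even integer $n$ with $p-1\nmid n$ such that, for all positive integers $m,b$ with $b>2\lfloor(pn-1)/(p-1)\rfloor$, in both equalities the left-hand side is strictly greater than the right-hand side. -/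

import Mathlib

/-- Fleck's sum `C_p(n, r) = ∑_{k ≡ r (mod p)} (n choose k) (-1)^k`. -/
def fleckSum (p n : ℕ) (r : ℤ) : ℤ :=
  ∑ k ∈ (Finset.range (n + 1)).filter (fun k : ℕ => (k : ℤ) ≡ r [ZMOD (p : ℤ)]),
    (n.choose k : ℤ) * (-1) ^ k

/-- The floor `⌊(n - 1) / (p - 1)⌋` (integer division rounds down, since `p - 1 > 0` for a
prime `p`); it is `-1` for `n = 0`. -/
def fleckExponent (p n : ℕ) : ℤ := ((n : ℤ) - 1) / ((p : ℤ) - 1)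

/-- The Fleck quotient
`F_p(n, r) = (-p)^(-⌊(n-1)/(p-1)⌋) ∑_{k ≡ r (mod p)} (n choose k) (-1)^k + [n = 0]`,
as a rational number. -/
def fleckQuotient (p n : ℕ) (r : ℤ) : ℚ :=
  (-(p : ℚ)) ^ (-fleckExponent p n) * (fleckSum p n r : ℚ) + (if n = 0 then 1 else 0)

/-- The smallest positive residue of `n` modulo `d` (in `{1, …, d}` for `d > 0`). -/
def leastPosResidue (n d : ℕ) : ℕ := if n % d = 0 then d else n % d

/-- Congruence modulo `p` in the ring of `p`-adic integers, for rational numbers: `x` and `y` are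
both `p`-adic integers, and `p` divides their difference in `ℤ_p`. -/
def PadicIntCongr (p : ℕ) [Fact p.Prime] (x y : ℚ) : Prop :=
  ∃ u v : ℤ_[p], (u : ℚ_[p]) = (x : ℚ_[p]) ∧ (v : ℚ_[p]) = (y : ℚ_[p]) ∧ (p : ℤ_[p]) ∣ u - v

/-!
The power sums of the numbers `1 - ζ`, with `ζ` running over the `p`-th roots of unity, are
`p C_p(N, 0)`, and the polynomial with these reciprocal roots is `(1 - X) ^ p + X ^ p`. Hence
`p C_p(N, 0) / N` is the coefficient of `X ^ N` in `-log ((1 - X) ^ p + X ^ p)`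
(`fleckSum_zero_eq_sum`), and the division by `N` that the theorem asks for comes for free.

Write `(1 - X) ^ p + X ^ p = 1 - p X h` with an integral polynomial `h` of degree `p - 2` whose
coefficients are antisymmetric, and expand the logarithm: `p C_p(N, 0) / N` is the sum over `m` of
`± (p ^ m / m) [X ^ J] h ^ m` with `J = (p - 1) m - N`. Take `N = p n`, and let `a` and `q` be the
remainder and the quotient of `n` by `p - 1`.
* For `m ≤ n + q` the index `J` is negative and there is no contribution.
* For `m > n + q + 1` the term is negligible: `J [X ^ J] h ^ m` is divisible by `m`, and `J` is not
  divisible by a large power of `p` (`not_pow_dvd_of_add_eq`).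
* For `m = n + q + 1` we have `m ≡ a + 1` and `J = p - 1 - a`. Modulo `p`, `h ^ p` is `1` up to
  degree `p - 1` and `h` is `-log (1 - X) / X`, so that the coefficient is a Stirling number of the
  first kind `[p, a + 1]` divided by `p`. Newton's identities and Faulhaber's formula identify the
  latter with a Bernoulli number (`natCast_mul_stirlingFirst_div_ratModEq`).

This is `fleckSum_prime_mul_div_ratModEq`. The explicit formula
`k! S(M, k) = ∑ (-1) ^ (k - i) (k choose i) i ^ M` and Euler's theorem make
`k! S(m φ(p ^ b), k)` congruent to `-(-1) ^ k C_p(k, 0)` modulo `p ^ b`, and Pascal's rule with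
the symmetry `k ↦ n - k` gives `C_p(p n, 0) = 2 C_p(p n - 1, 0)`; this transfers the congruence to
Stirling numbers of the second kind.

The conjectured valuations hold exactly when the common value of the congruences is nonzero
modulo `p`. It vanishes for the irregular prime `p = 37` and `n = 4`, because `37` divides the
numerator of `B_32`.
-/

/-! ### Congruences in the ring of `p`-integral rational numbers -/

/-- The ring `ℤ_(p)` of rational numbers that are `p`-adic integers. -/
noncomputable def pIntegralRat (p : ℕ) [Fact p.Prime] : Subring ℚ :=
  (PadicInt.subring p).comap (algebraMap ℚ ℚ_[p])

/-- `x ≡ y` modulo `p ℤ_(p)`. Neither side is required to be `p`-integral. -/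
def RatModEq (p : ℕ) [Fact p.Prime] (x y : ℚ) : Prop :=
  ∃ z ∈ pIntegralRat p, x - y = p * z

section

variable {p : ℕ} [hp : Fact p.Prime]

theorem mem_pIntegralRat {x : ℚ} : x ∈ pIntegralRat p ↔ ‖(x : ℚ_[p])‖ ≤ 1 := Iff.rfl

theorem inv_natCast_mem_pIntegralRat {k : ℕ} (hk : ¬ p ∣ k) : (k : ℚ)⁻¹ ∈ pIntegralRat p := by
  have h : ‖(k : ℚ_[p])‖ = 1 := by
    rw [← PadicInt.coe_natCast, PadicInt.padic_norm_e_of_padicInt, PadicInt.norm_natCast_eq_one_iff]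
    exact (Nat.Prime.coprime_iff_not_dvd hp.out).2 hk
  rw [mem_pIntegralRat]
  push_cast
  rw [norm_inv, h, inv_one]

theorem div_natCast_mem_pIntegralRat {x : ℚ} {k : ℕ} (hx : x ∈ pIntegralRat p) (hk : ¬ p ∣ k) :
    x / k ∈ pIntegralRat p := by
  rw [div_eq_mul_inv]
  exact mul_mem hx (inv_natCast_mem_pIntegralRat hk)

theorem pow_div_mem_pIntegralRat {i J : ℕ} (hJ : ¬ p ^ (i + 1) ∣ J) :
    (p : ℚ) ^ i / J ∈ pIntegralRat p := by
  have hJ0 : J ≠ 0 := by rintro rfl; exact hJ (dvd_zero _)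
  obtain ⟨v, u, hu, rfl⟩ := Nat.exists_eq_pow_mul_and_not_dvd hJ0 p hp.out.ne_one
  have hv : v ≤ i := by
    by_contra h
    exact hJ ((pow_dvd_pow p (by omega)).mul_right u)
  have hp0 : (p : ℚ) ≠ 0 := by exact_mod_cast hp.out.ne_zero
  have hu0 : (u : ℚ) ≠ 0 := by
    rintro h
    exact hu (by rw [Nat.cast_eq_zero.1 h]; exact dvd_zero _)
  obtain ⟨w, rfl⟩ := Nat.exists_eq_add_of_le hv
  have : (p : ℚ) ^ (v + w) / ((p ^ v * u : ℕ) : ℚ) = (p : ℚ) ^ w / u := by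
    push_cast
    field_simp
    ring
  rw [this]
  exact div_natCast_mem_pIntegralRat (pow_mem (natCast_mem _ p) w) hu

theorem intCast_div_mem_pIntegralRat {z : ℤ} {k : ℕ} (hk : ¬ p ∣ k) :
    (z : ℚ) / k ∈ pIntegralRat p :=
  div_natCast_mem_pIntegralRat (intCast_mem _ z) hk

namespace RatModEq

theorem refl (x : ℚ) : RatModEq p x x := ⟨0, zero_mem _, by simp⟩

theorem symm {x y : ℚ} (h : RatModEq p x y) : RatModEq p y x := by
  obtain ⟨z, hz, e⟩ := h
  exact ⟨-z, neg_mem hz, by linear_combination -e⟩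

theorem trans {x y z : ℚ} (h : RatModEq p x y) (h' : RatModEq p y z) : RatModEq p x z := by
  obtain ⟨u, hu, e⟩ := h
  obtain ⟨v, hv, e'⟩ := h'
  exact ⟨u + v, add_mem hu hv, by linear_combination e + e'⟩

theorem add {x y x' y' : ℚ} (h : RatModEq p x y) (h' : RatModEq p x' y') :
    RatModEq p (x + x') (y + y') := by
  obtain ⟨u, hu, e⟩ := h
  obtain ⟨v, hv, e'⟩ := h'
  exact ⟨u + v, add_mem hu hv, by linear_combination e + e'⟩

theorem neg {x y : ℚ} (h : RatModEq p x y) : RatModEq p (-x) (-y) := by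
  obtain ⟨u, hu, e⟩ := h
  exact ⟨-u, neg_mem hu, by linear_combination -e⟩

theorem mul_left {x y c : ℚ} (hc : c ∈ pIntegralRat p) (h : RatModEq p x y) :
    RatModEq p (c * x) (c * y) := by
  obtain ⟨u, hu, e⟩ := h
  exact ⟨c * u, mul_mem hc hu, by linear_combination c * e⟩

theorem mul {x y x' y' : ℚ} (hx : x ∈ pIntegralRat p) (hy' : y' ∈ pIntegralRat p)
    (h : RatModEq p x y) (h' : RatModEq p x' y') : RatModEq p (x * x') (y * y') := by
  refine (h'.mul_left hx).trans ?_
  rw [mul_comm x, mul_comm y]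
  exact h.mul_left hy'

theorem sum {ι : Type*} {s : Finset ι} {f g : ι → ℚ} (h : ∀ i ∈ s, RatModEq p (f i) (g i)) :
    RatModEq p (∑ i ∈ s, f i) (∑ i ∈ s, g i) := by
  classical
  induction s using Finset.induction_on with
  | empty => exact refl _
  | insert a s ha ih =>
    rw [Finset.sum_insert ha, Finset.sum_insert ha]
    exact (h a (Finset.mem_insert_self a s)).add
      (ih fun i hi => h i (Finset.mem_insert_of_mem hi))

theorem mem {x y : ℚ} (h : RatModEq p x y) (hy : y ∈ pIntegralRat p) : x ∈ pIntegralRat p := by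
  obtain ⟨u, hu, e⟩ := h
  have : x = y + p * u := by linear_combination e
  rw [this]
  exact add_mem hy (mul_mem (natCast_mem _ p) hu)

theorem of_dvd {x y : ℤ} (h : (p : ℤ) ∣ x - y) : RatModEq p x y := by
  obtain ⟨u, hu⟩ := h
  exact ⟨u, intCast_mem _ u, by exact_mod_cast hu⟩

theorem of_mul_left {x y : ℚ} {k : ℕ} (hk : ¬ p ∣ k) (h : RatModEq p (k * x) (k * y)) :
    RatModEq p x y := by
  have hk0 : (k : ℚ) ≠ 0 := by
    rintro h
    exact hk (by rw [Nat.cast_eq_zero.1 h]; exact dvd_zero _)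
  have := h.mul_left (inv_natCast_mem_pIntegralRat hk)
  rwa [inv_mul_cancel_left₀ hk0, inv_mul_cancel_left₀ hk0] at this

theorem padicIntCongr {x y : ℚ} (h : RatModEq p x y) (hy : y ∈ pIntegralRat p) :
    PadicIntCongr p x y := by
  have hx := h.mem hy
  obtain ⟨z, hz, e⟩ := h
  refine ⟨⟨x, hx⟩, ⟨y, hy⟩, rfl, rfl, ⟨z, hz⟩, ?_⟩
  apply Subtype.ext
  have : ((x - y : ℚ) : ℚ_[p]) = ((p * z : ℚ) : ℚ_[p]) := by rw [e]
  push_cast at this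
  exact this

end RatModEq

/-- An integer that vanishes modulo `p` after division by `p ^ k` is divisible by `p ^ (k + 1)`. -/
theorem pow_succ_dvd_of_ratModEq {x : ℤ} {k : ℕ} (h : RatModEq p (x / (p : ℚ) ^ k) 0) :
    (p : ℤ) ^ (k + 1) ∣ x := by
  obtain ⟨z, hz, e⟩ := h
  have hp0 : (p : ℚ) ≠ 0 := by exact_mod_cast hp.out.ne_zero
  rw [sub_zero, div_eq_iff (pow_ne_zero _ hp0)] at e
  have e' : (x : ℚ_[p]) = (p : ℚ_[p]) ^ (k + 1) * (z : ℚ_[p]) := by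
    have : ((x : ℚ) : ℚ_[p]) = ((p * z * p ^ k : ℚ) : ℚ_[p]) := by rw [e]
    push_cast at this
    rw [this]
    ring
  rw [← PadicInt.pow_p_dvd_int_iff]
  refine ⟨⟨z, hz⟩, Subtype.ext ?_⟩
  push_cast
  exact e'

/-- Two power series over `ℚ` whose coefficients of degree less than `d` are `p`-integral and
congruent modulo `p`. -/
def PowerSeriesModEq (p : ℕ) [Fact p.Prime] (d : ℕ) (A B : PowerSeries ℚ) : Prop :=
  ∀ i < d, A.coeff i ∈ pIntegralRat p ∧ B.coeff i ∈ pIntegralRat p ∧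
    RatModEq p (A.coeff i) (B.coeff i)

namespace PowerSeriesModEq

variable {d : ℕ} {A A' B B' : PowerSeries ℚ}

theorem mul (h : PowerSeriesModEq p d A B) (h' : PowerSeriesModEq p d A' B') :
    PowerSeriesModEq p d (A * A') (B * B') := by
  intro i hi
  simp only [PowerSeries.coeff_mul]
  have hd : ∀ x ∈ Finset.HasAntidiagonal.antidiagonal i, x.1 < d ∧ x.2 < d := by
    intro x hx
    have := Finset.HasAntidiagonal.mem_antidiagonal.1 hx
    omega
  refine ⟨sum_mem fun x hx => ?_, sum_mem fun x hx => ?_, RatModEq.sum fun x hx => ?_⟩ <;>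
    obtain ⟨a1, b1, c1⟩ := h x.1 (hd x hx).1 <;>
    obtain ⟨a2, b2, c2⟩ := h' x.2 (hd x hx).2
  · exact mul_mem a1 a2
  · exact mul_mem b1 b2
  · exact c1.mul a1 b2 c2

theorem one : PowerSeriesModEq p d 1 1 := by
  intro i _
  have : PowerSeries.coeff i (1 : PowerSeries ℚ) ∈ pIntegralRat p := by
    rw [PowerSeries.coeff_one]
    split_ifs
    exacts [one_mem _, zero_mem _]
  exact ⟨this, this, RatModEq.refl _⟩

theorem pow (h : PowerSeriesModEq p d A B) (m : ℕ) : PowerSeriesModEq p d (A ^ m) (B ^ m) := by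
  induction m with
  | zero => simpa using one
  | succ m ih => simpa only [pow_succ] using ih.mul h

end PowerSeriesModEq

end

/-! ### The generating function of Fleck's sums -/

theorem fleckSum_eq_sum_ite (p n : ℕ) (r : ℤ) :
    fleckSum p n r = ∑ k ∈ Finset.range (n + 1),
      if (p : ℤ) ∣ (k : ℤ) - r then (n.choose k : ℤ) * (-1) ^ k else 0 := by
  rw [fleckSum, Finset.sum_filter]
  refine Finset.sum_congr rfl fun k _ => ?_
  simp only [Int.modEq_comm (a := (k : ℤ)), Int.modEq_iff_dvd]

/-- Pascal's rule. -/
theorem fleckSum_succ (p n : ℕ) (r : ℤ) :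
    fleckSum p (n + 1) r = fleckSum p n r - fleckSum p n (r - 1) := by
  have h1 : fleckSum p n r = ∑ k ∈ Finset.range (n + 1 + 1),
      if (p : ℤ) ∣ (k : ℤ) - r then (n.choose k : ℤ) * (-1) ^ k else 0 := by
    rw [Finset.sum_range_succ, fleckSum_eq_sum_ite]
    simp
  rw [h1, fleckSum_eq_sum_ite, fleckSum_eq_sum_ite, Finset.sum_range_succ',
    Finset.sum_range_succ' _ (n + 1), add_sub_right_comm, ← Finset.sum_sub_distrib]
  congr 1
  · refine Finset.sum_congr rfl fun k _ => ?_
    have : ((k + 1 : ℕ) : ℤ) - r = k - (r - 1) := by push_cast; ring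
    rw [this]
    split_ifs
    · rw [Nat.choose_succ_succ]
      push_cast
      ring
    · simp
  · simp

theorem fleckSum_add_natCast (p n : ℕ) (r : ℤ) : fleckSum p n (r + p) = fleckSum p n r := by
  simp only [fleckSum_eq_sum_ite]
  refine Finset.sum_congr rfl fun k _ => ?_
  have : (k : ℤ) - (r + p) = k - r - p := by ring
  simp only [this, dvd_sub_self_right]

/-- The ordinary generating function `∑_N C_p(N, r) X ^ N` of Fleck's sums. -/
noncomputable def fleckSeries (p : ℕ) (r : ℤ) : PowerSeries ℚ :=
  PowerSeries.mk fun N => (fleckSum p N r : ℚ)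

open PowerSeries in
theorem fleckSeries_mul_one_sub_X (p : ℕ) (r : ℤ) :
    fleckSeries p r * (1 - X) = (if (p : ℤ) ∣ r then 1 else 0) - X * fleckSeries p (r - 1) := by
  ext N
  cases N with
  | zero =>
    have : fleckSum p 0 r = if (p : ℤ) ∣ r then 1 else 0 := by
      simp [fleckSum_eq_sum_ite]
    simp only [coeff_zero_eq_constantCoeff, map_mul, map_sub, map_one, constantCoeff_X, sub_zero,
      mul_one, zero_mul]
    rw [← coeff_zero_eq_constantCoeff_apply, fleckSeries, coeff_mk, this]
    split_ifs <;> simp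
  | succ N =>
    have : coeff (N + 1) (if (p : ℤ) ∣ r then (1 : PowerSeries ℚ) else 0) = 0 := by
      split_ifs
      · rw [coeff_one, if_neg N.succ_ne_zero]
      · simp
    rw [mul_sub, mul_one, map_sub, map_sub, coeff_succ_mul_X, coeff_succ_X_mul, this]
    simp only [fleckSeries, coeff_mk]
    rw [fleckSum_succ]
    push_cast
    ring

open PowerSeries in
theorem fleckSeries_natCast_mul_one_sub_X_pow (p m : ℕ) (hm : m < p) :
    fleckSeries p m * (1 - X) ^ m = (-X) ^ m * fleckSeries p 0 := by
  induction m with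
  | zero => simp
  | succ m ih =>
    have hnd : ¬ (p : ℤ) ∣ ((m + 1 : ℕ) : ℤ) := by
      rw [Int.natCast_dvd_natCast]
      exact Nat.not_dvd_of_pos_of_lt m.succ_pos hm
    have h := fleckSeries_mul_one_sub_X p ((m + 1 : ℕ) : ℤ)
    rw [if_neg hnd, Nat.cast_succ, add_sub_cancel_right] at h
    rw [Nat.cast_succ]
    linear_combination (1 - X) ^ m * h - X * ih (by omega)

open PowerSeries in
/-- Iterating Pascal's rule `p` times returns to the residue class `0` and so determines the
generating function as a rational function. -/
theorem fleckSeries_zero_mul (p : ℕ) (hp : Odd p) :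
    fleckSeries p 0 * ((1 - X) ^ p + X ^ p) = (1 - X) ^ (p - 1) := by
  obtain ⟨k, rfl⟩ := hp
  have h0 := fleckSeries_mul_one_sub_X (2 * k + 1) 0
  have h1 := fleckSeries_natCast_mul_one_sub_X_pow (2 * k + 1) (2 * k) (by omega)
  have h2 : fleckSeries (2 * k + 1) (0 - 1) = fleckSeries (2 * k + 1) ((2 * k : ℕ) : ℤ) := by
    rw [fleckSeries, fleckSeries]
    congr 1
    ext N
    rw [← fleckSum_add_natCast]
    congr 2
    push_cast
    ring
  rw [if_pos (dvd_zero _), h2] at h0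
  rw [(even_two_mul k).neg_pow] at h1
  rw [Nat.add_sub_cancel]
  linear_combination (1 - X) ^ (2 * k) * h0 - X * h1

/-! ### Fleck's sums as coefficients of a logarithm -/

/-- The polynomial `h` with `(1 - X) ^ p + X ^ p = 1 - p X h`, for an odd prime `p`. Its
coefficients `(-1) ^ k (p choose k + 1) / p` are integers (here a natural number division that
leaves no remainder). -/
noncomputable def fleckPoly (p : ℕ) : Polynomial ℤ :=
  ∑ k ∈ Finset.range (p - 1), Polynomial.monomial k ((-1) ^ k * ((p.choose (k + 1) / p : ℕ) : ℤ))

/-- `fleckPoly p` as a power series with rational coefficients. -/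
noncomputable def fleckPolySeries (p : ℕ) : PowerSeries ℚ :=
  ((fleckPoly p).map (Int.castRingHom ℚ) : PowerSeries ℚ)

theorem coeff_fleckPoly (p k : ℕ) : (fleckPoly p).coeff k =
    if k < p - 1 then (-1) ^ k * ((p.choose (k + 1) / p : ℕ) : ℤ) else 0 := by
  simp [fleckPoly, Polynomial.coeff_monomial]

theorem coeff_fleckPolySeries_pow (p m k : ℕ) :
    PowerSeries.coeff k (fleckPolySeries p ^ m) = ((fleckPoly p ^ m).coeff k : ℚ) := by
  rw [fleckPolySeries, ← Polynomial.coe_pow, ← Polynomial.map_pow, Polynomial.coeff_coe,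
    Polynomial.coeff_map, eq_intCast]

theorem natCast_mul_choose_div {p : ℕ} (hp : p.Prime) {k : ℕ} (hk : k < p - 1) :
    p * (p.choose (k + 1) / p) = p.choose (k + 1) :=
  Nat.mul_div_cancel' (hp.dvd_choose_self k.succ_ne_zero (by omega))

open PowerSeries in
theorem one_sub_X_pow_add_X_pow {p : ℕ} (hp : p.Prime) (h2 : Odd p) :
    ((1 - X) ^ p + X ^ p : PowerSeries ℚ) = 1 - (p : PowerSeries ℚ) * X * fleckPolySeries p := by
  obtain ⟨k, hk⟩ := h2
  have hk1 : p - 1 = 2 * k := by omega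
  have e1 : fleckPolySeries p = ∑ i ∈ Finset.range (2 * k),
      PowerSeries.C ((-1 : ℚ) ^ i * ((p.choose (i + 1) / p : ℕ) : ℚ)) * X ^ i := by
    rw [fleckPolySeries, fleckPoly, hk1]
    simp only [Polynomial.map_sum, Polynomial.map_monomial]
    rw [← Polynomial.coeToPowerSeries.ringHom_apply, map_sum]
    refine Finset.sum_congr rfl fun i _ => ?_
    rw [Polynomial.coeToPowerSeries.ringHom_apply, Polynomial.coe_monomial,
      PowerSeries.monomial_eq_C_mul_X_pow]
    simp only [eq_intCast, Int.cast_mul, Int.cast_pow, Int.cast_neg, Int.cast_one, Int.cast_natCast]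
  have e2 : ((1 - X) ^ p : PowerSeries ℚ) = 1 - X ^ p +
      ∑ i ∈ Finset.range (2 * k), (-X) ^ (i + 1) * (p.choose (i + 1) : PowerSeries ℚ) := by
    have : (1 - X : PowerSeries ℚ) = -X + 1 := by ring
    rw [this, add_pow, Finset.sum_range_succ]
    nth_rewrite 1 [hk]
    rw [Finset.sum_range_succ']
    simp only [one_pow, mul_one, pow_zero, Nat.choose_zero_right, Nat.cast_one, Nat.choose_self]
    rw [Odd.neg_pow ⟨k, hk⟩]
    ring
  rw [e1, e2, Finset.mul_sum, sub_add_eq_add_sub, sub_add_cancel, sub_eq_add_neg,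
    ← Finset.sum_neg_distrib]
  congr 1
  refine Finset.sum_congr rfl fun i hi => ?_
  have hc : (p.choose (i + 1) : PowerSeries ℚ) = p * (p.choose (i + 1) / p : ℕ) := by
    rw [← Nat.cast_mul, natCast_mul_choose_div hp (by rw [hk1]; exact Finset.mem_range.1 hi)]
  simp only [hc, map_mul, map_pow, map_neg, map_one, map_natCast]
  rw [neg_pow]
  ring

open PowerSeries in
/-- The logarithmic derivative of `(1 - X) ^ p + X ^ p = ∏_ζ (1 - (1 - ζ) X)`, with `ζ` running
over the `p`-th roots of unity, generates the power sums `∑_ζ (1 - ζ) ^ N = p C_p(N, 0)`;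
integrating gives `p C_p(N, 0) / N = [X ^ N] (-log ((1 - X) ^ p + X ^ p))`. -/
theorem fleckSum_zero_eq_sum {p : ℕ} (hp : p.Prime) (h2 : Odd p) {N : ℕ} (hN : 0 < N) :
    (p : ℚ) * fleckSum p N 0 = N * ∑ m ∈ Finset.Icc 1 N,
      (p : ℚ) ^ m / m * ((fleckPoly p ^ m).coeff (N - m) : ℚ) := by
  set U : PowerSeries ℚ := (p : PowerSeries ℚ) * X * fleckPolySeries p with hU
  set G : PowerSeries ℚ := ∑ m ∈ Finset.range N, C (((m + 1 : ℕ) : ℚ)⁻¹) * U ^ (m + 1) with hG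
  have hP := one_sub_X_pow_add_X_pow hp h2
  have hS := fleckSeries_zero_mul p h2
  have hp1 : p - 1 + 1 = p := Nat.sub_add_cancel hp.one_le
  have dU : X * d⁄dX ℚ U =
      (p : PowerSeries ℚ) * (1 - X) ^ (p - 1) - (p : PowerSeries ℚ) * ((1 - X) ^ p + X ^ p) := by
    have hU' : U = 1 - ((1 - X) ^ p + X ^ p) := by rw [hP]; ring
    rw [hU']
    simp only [map_sub, map_add, Derivation.leibniz_pow, derivative_X, ← map_one C, derivative_C]
    simp only [map_one, nsmul_eq_mul, smul_eq_mul]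
    have e1 : (1 - X : PowerSeries ℚ) ^ p = (1 - X) ^ (p - 1) * (1 - X) := by
      rw [← pow_succ, hp1]
    have e2 : (X : PowerSeries ℚ) ^ p = X ^ (p - 1) * X := by rw [← pow_succ, hp1]
    rw [e1, e2]
    ring
  have dG : d⁄dX ℚ G = (∑ m ∈ Finset.range N, U ^ m) * d⁄dX ℚ U := by
    rw [hG, map_sum, Finset.sum_mul]
    refine Finset.sum_congr rfl fun m _ => ?_
    rw [Derivation.leibniz, derivative_C, Derivation.leibniz_pow]
    simp only [nsmul_eq_mul, smul_eq_mul, mul_zero, add_zero, Nat.add_sub_cancel]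
    have : C (((m + 1 : ℕ) : ℚ)⁻¹) * ((m + 1 : ℕ) : PowerSeries ℚ) = 1 := by
      rw [← map_natCast (C (R := ℚ)), ← map_mul, inv_mul_cancel₀ (by positivity), map_one]
    linear_combination (U ^ m * d⁄dX ℚ U) * this
  -- `G` is `-log (1 - U)` truncated at degree `N`, so the two logarithmic derivatives agree modulo
  -- `X ^ (N + 1)`.
  have key :
      ((p : PowerSeries ℚ) * fleckSeries p 0 - (p : PowerSeries ℚ) - X * d⁄dX ℚ G) * (1 - U) =
      X ^ (N + 1) * (((p : PowerSeries ℚ) * fleckPolySeries p) ^ N * d⁄dX ℚ U) := by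
    have hgeom := mul_neg_geom_sum U N
    have hUN : X ^ N * ((p : PowerSeries ℚ) * fleckPolySeries p) ^ N = U ^ N := by
      rw [hU, ← mul_pow]; ring
    have hP' : (1 - X) ^ p + X ^ p = 1 - U := hP
    rw [dG]
    rw [hP'] at hS dU
    linear_combination (p : PowerSeries ℚ) * hS - dU - X * d⁄dX ℚ U * hgeom - X * d⁄dX ℚ U * hUN
  have hunit : IsUnit (1 - U) := by
    rw [isUnit_iff_constantCoeff, hU]
    simp
  have hdvd : (X : PowerSeries ℚ) ^ (N + 1) ∣
      (p : PowerSeries ℚ) * fleckSeries p 0 - (p : PowerSeries ℚ) - X * d⁄dX ℚ G :=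
    hunit.dvd_mul_right.1 ⟨_, key⟩
  have h0 := X_pow_dvd_iff.1 hdvd N (Nat.lt_succ_self N)
  obtain ⟨M, rfl⟩ : ∃ M, N = M + 1 := ⟨N - 1, by omega⟩
  have hc : coeff (M + 1) (p : PowerSeries ℚ) = 0 := by
    rw [← map_natCast (C (R := ℚ)), coeff_C, if_neg M.succ_ne_zero]
  have hc2 : coeff (M + 1) ((p : PowerSeries ℚ) * fleckSeries p 0) =
      p * fleckSum p (M + 1) 0 := by
    rw [← map_natCast (C (R := ℚ)), coeff_C_mul, fleckSeries, coeff_mk]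
  rw [map_sub, map_sub, hc, hc2, sub_zero, coeff_succ_X_mul, coeff_derivative, sub_eq_zero] at h0
  rw [h0, mul_comm, hG, map_sum, Nat.cast_succ]
  congr 1
  rw [Finset.range_eq_Ico, Finset.sum_Ico_add' (fun m : ℕ => coeff (M + 1) (C ((m : ℚ)⁻¹) * U ^ m))]
  refine Finset.sum_congr (by ext; simp) fun m hm => ?_
  have hm' : m ≤ M + 1 := (Finset.mem_Icc.1 hm).2
  have : C ((m : ℚ)⁻¹) * U ^ m = C ((p : ℚ) ^ m / m) * (X ^ m * fleckPolySeries p ^ m) := by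
    rw [hU, div_eq_inv_mul, map_mul, map_pow, map_natCast]
    ring
  rw [this, coeff_C_mul, coeff_X_pow_mul', if_pos hm', coeff_fleckPolySeries_pow]

/-! ### The coefficients of powers of the Fleck polynomial -/

theorem natDegree_fleckPoly_le (p : ℕ) : (fleckPoly p).natDegree ≤ p - 2 := by
  rw [Polynomial.natDegree_le_iff_coeff_eq_zero]
  intro k hk
  rw [coeff_fleckPoly, if_neg (by omega)]

/-- The symmetry `(p choose k + 1) = (p choose p - 1 - k)`; the sign comes from `p` being odd. -/
theorem reflect_fleckPoly {p : ℕ} (hp : 2 ≤ p) (h2 : Odd p) :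
    Polynomial.reflect (p - 2) (fleckPoly p) = -fleckPoly p := by
  ext k
  rw [Polynomial.coeff_reflect, Polynomial.coeff_neg]
  by_cases hk : k ≤ p - 2
  · rw [Polynomial.revAt_le hk, coeff_fleckPoly, coeff_fleckPoly, if_pos (by omega),
      if_pos (by omega)]
    have e1 : p.choose (p - 2 - k + 1) = p.choose (k + 1) := by
      rw [← Nat.choose_symm (by omega : k + 1 ≤ p)]
      congr 1
      omega
    have e2 : (-1 : ℤ) ^ (p - 2 - k) = -(-1) ^ k := by
      have h : (-1 : ℤ) ^ (p - 2 - k) * (-1) ^ k = -1 := by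
        rw [← pow_add, Nat.sub_add_cancel hk]
        exact Odd.neg_one_pow (by obtain ⟨c, rfl⟩ := h2; exact ⟨c - 1, by omega⟩)
      have h' : (-1 : ℤ) ^ k * (-1) ^ k = 1 := by rw [← mul_pow]; norm_num
      linear_combination (-1) ^ k * h - (-1) ^ (p - 2 - k) * h'
    rw [e1, e2]
    ring
  · rw [Polynomial.revAt_eq_self_of_lt (by omega), coeff_fleckPoly, if_neg (by omega), neg_zero]

theorem reflect_fleckPoly_pow {p : ℕ} (hp : 2 ≤ p) (h2 : Odd p) (m : ℕ) :
    Polynomial.reflect ((p - 2) * m) (fleckPoly p ^ m) = (-1) ^ m * fleckPoly p ^ m := by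
  induction m with
  | zero => simp [Polynomial.reflect_one]
  | succ m ih =>
    rw [pow_succ, Nat.mul_succ, Polynomial.reflect_mul _ _ _ (natDegree_fleckPoly_le p), ih,
      reflect_fleckPoly hp h2]
    · ring
    · refine Polynomial.natDegree_pow_le.trans ?_
      rw [mul_comm]
      exact Nat.mul_le_mul_right _ (natDegree_fleckPoly_le p)

theorem coeff_fleckPoly_pow_eq_zero {p m k : ℕ} (hk : (p - 2) * m < k) :
    (fleckPoly p ^ m).coeff k = 0 := by
  refine Polynomial.coeff_eq_zero_of_natDegree_lt (lt_of_le_of_lt ?_ hk)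
  refine Polynomial.natDegree_pow_le.trans ?_
  rw [mul_comm]
  exact Nat.mul_le_mul_right _ (natDegree_fleckPoly_le p)

theorem coeff_fleckPoly_pow_symm {p : ℕ} (hp : 2 ≤ p) (h2 : Odd p) {m k l : ℕ}
    (h : k + l = (p - 2) * m) :
    (fleckPoly p ^ m).coeff k = (-1) ^ m * (fleckPoly p ^ m).coeff l := by
  have := congrArg (fun f => Polynomial.coeff f l) (reflect_fleckPoly_pow hp h2 m)
  simp only [Polynomial.coeff_reflect] at this
  rw [Polynomial.revAt_le (by omega), show (p - 2) * m - l = k by omega] at this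
  rw [this]
  have hC : ((-1) ^ m : Polynomial ℤ) = Polynomial.C ((-1) ^ m) := by simp
  rw [hC, Polynomial.coeff_C_mul]

/-- Differentiating `f ^ m` shows that `k [X ^ k] f ^ m` is divisible by `m`. -/
theorem dvd_mul_coeff_pow (f : Polynomial ℤ) (m k : ℕ) :
    (m : ℤ) ∣ k * (f ^ m).coeff k := by
  cases k with
  | zero => simp
  | succ k =>
    have h := Polynomial.coeff_derivative (f ^ m) k
    rw [Polynomial.derivative_pow, mul_assoc, Polynomial.coeff_C_mul] at h
    exact ⟨_, by rw [h]; push_cast; ring⟩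

theorem coeff_zero_fleckPoly {p : ℕ} (hp : 2 ≤ p) : (fleckPoly p).coeff 0 = 1 := by
  rw [coeff_fleckPoly, if_pos (by omega)]
  simp [Nat.div_self (by omega : 0 < p)]

/-! ### Stirling numbers of the first kind and powers of `-log (1 - X)` -/

/-- The power series `-log (1 - X) / X = ∑ X ^ k / (k + 1)`. -/
noncomputable def negLogDivX : PowerSeries ℚ := PowerSeries.mk fun k => ((k : ℚ) + 1)⁻¹

open PowerSeries in
theorem derivative_X_mul_negLogDivX_mul : d⁄dX ℚ (X * negLogDivX) * (1 - X) = 1 := by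
  have : d⁄dX ℚ (X * negLogDivX) = PowerSeries.mk 1 := by
    ext k
    rw [coeff_derivative, coeff_succ_X_mul, negLogDivX, coeff_mk, coeff_mk]
    exact inv_mul_cancel₀ (by positivity)
  rw [this, mk_one_mul_one_sub_eq_one]

open PowerSeries in
/-- The exponential generating function of the unsigned Stirling numbers of the first kind is
`(-log (1 - X)) ^ M / M!`. -/
theorem coeff_X_mul_negLogDivX_pow_mul_factorial (k M : ℕ) :
    coeff k ((X * negLogDivX) ^ M) * (k.factorial : ℚ) =
      (M.factorial : ℚ) * (Nat.stirlingFirst k M : ℚ) := by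
  induction k generalizing M with
  | zero =>
    cases M with
    | zero => simp
    | succ M => simp
  | succ k ih =>
    cases M with
    | zero => simp [coeff_one]
    | succ M =>
      have hd : d⁄dX ℚ ((X * negLogDivX) ^ (M + 1)) * (1 - X) =
          C ((M : ℚ) + 1) * (X * negLogDivX) ^ M := by
        rw [Derivation.leibniz_pow, Nat.add_sub_cancel, nsmul_eq_mul, smul_eq_mul, map_add, map_one,
          map_natCast]
        push_cast
        linear_combination (((M : PowerSeries ℚ) + 1) * (X * negLogDivX) ^ M) *
          derivative_X_mul_negLogDivX_mul
      have hc := congrArg (coeff k) hd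
      rw [mul_sub, mul_one, map_sub, coeff_C_mul, coeff_derivative] at hc
      have hk : coeff k (d⁄dX ℚ ((X * negLogDivX) ^ (M + 1)) * X) =
          (k : ℚ) * coeff k ((X * negLogDivX) ^ (M + 1)) := by
        cases k with
        | zero => simp
        | succ k =>
          rw [coeff_succ_mul_X, coeff_derivative]
          push_cast
          ring
      rw [hk] at hc
      have h1 := ih (M + 1)
      have h2 := ih M
      rw [Nat.stirlingFirst_succ_succ]
      rw [Nat.factorial_succ] at h1 ⊢
      rw [Nat.factorial_succ M]
      push_cast at h1 ⊢
      linear_combination (k.factorial : ℚ) * hc + (k : ℚ) * h1 + ((M : ℚ) + 1) * h2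

theorem coeff_negLogDivX_pow (j M : ℕ) :
    PowerSeries.coeff j (negLogDivX ^ M) =
      (M.factorial : ℚ) * (Nat.stirlingFirst (j + M) M : ℚ) / ((j + M).factorial : ℚ) := by
  rw [eq_div_iff (by positivity), ← coeff_X_mul_negLogDivX_pow_mul_factorial, mul_pow,
    PowerSeries.coeff_X_pow_mul]

/-! ### Stirling numbers of the first kind as elementary symmetric polynomials -/

theorem prod_X_add_C_natCast_coeff (n k : ℕ) :
    (∏ i ∈ Finset.range n, (Polynomial.X + Polynomial.C (i : ℤ))).coeff k =
      (Nat.stirlingFirst n k : ℤ) := by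
  induction n generalizing k with
  | zero =>
    cases k with
    | zero => simp
    | succ k => simp [Polynomial.coeff_one]
  | succ n ih =>
    rw [Finset.prod_range_succ, mul_add, Polynomial.coeff_add, Polynomial.coeff_mul_C, ih]
    cases k with
    | zero =>
      cases n with
      | zero => simp
      | succ n => simp
    | succ k =>
      rw [Polynomial.coeff_mul_X, ih, Nat.stirlingFirst_succ_succ]
      push_cast
      ring

/-- The `j`-th elementary symmetric function of `0, 1, …, n - 1`. -/
noncomputable def esymmRange (n j : ℕ) : ℤ :=
  MvPolynomial.aeval (fun i : Fin n => ((i : ℕ) : ℤ)) (MvPolynomial.esymm (Fin n) ℤ j)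

theorem esymmRange_eq_stirlingFirst {n j : ℕ} (hj : j ≤ n) :
    esymmRange n j = Nat.stirlingFirst n (n - j) := by
  rw [esymmRange, MvPolynomial.aeval_esymm_eq_multiset_esymm, ← prod_X_add_C_natCast_coeff]
  have hcard : (Finset.univ.val.map fun i : Fin n => ((i : ℕ) : ℤ)).card = n := by simp
  have := Multiset.prod_X_add_C_coeff (Finset.univ.val.map fun i : Fin n => ((i : ℕ) : ℤ))
    (k := n - j) (by rw [hcard]; omega)
  rw [hcard, Nat.sub_sub_self hj] at this
  rw [← this, Multiset.map_map, ← Fin.prod_univ_eq_prod_range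
    (fun i => Polynomial.X + Polynomial.C (i : ℤ))]
  rfl

/-- Newton's identity for `0, 1, …, n - 1`. -/
theorem natCast_mul_esymmRange (n j : ℕ) (hj : 0 < j) :
    (j : ℤ) * esymmRange n j = (-1) ^ (j + 1) * (∑ k ∈ Finset.range n, (k : ℤ) ^ j +
      ∑ i ∈ Finset.Ico 1 j,
        (-1) ^ i * esymmRange n i * ∑ k ∈ Finset.range n, (k : ℤ) ^ (j - i)) := by
  have h := congrArg (MvPolynomial.aeval fun i : Fin n => ((i : ℕ) : ℤ))
    (MvPolynomial.mul_esymm_eq_sum (Fin n) ℤ j)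
  have hps : ∀ l, MvPolynomial.aeval (fun i : Fin n => ((i : ℕ) : ℤ))
      (MvPolynomial.psum (Fin n) ℤ l) = ∑ k ∈ Finset.range n, (k : ℤ) ^ l := by
    intro l
    simp [MvPolynomial.psum, Fin.sum_univ_eq_sum_range (fun k => (k : ℤ) ^ l)]
  rw [Finset.sum_filter, Finset.Nat.sum_antidiagonal_eq_sum_range_succ_mk] at h
  simp only [map_mul, map_natCast, map_pow, map_neg, map_one, map_sum, apply_ite, map_zero,
    hps] at h
  rw [esymmRange, h, Finset.sum_range_succ, if_neg (lt_irrefl _), add_zero, Finset.range_eq_Ico,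
    Finset.sum_eq_sum_Ico_succ_bot hj]
  congr 2
  · simp [hj]
  · refine Finset.sum_congr rfl fun i hi => ?_
    rw [if_pos (Finset.mem_Ico.1 hi).2]
    rfl

/-! ### Bernoulli numbers of index less than `p - 1` -/

section

variable {p : ℕ} [hp : Fact p.Prime]

/-- The recurrence for `B_i` has denominators at most `i + 1 < p`. -/
theorem bernoulli_mem_pIntegralRat {i : ℕ} (hi : i < p - 1) : bernoulli i ∈ pIntegralRat p := by
  suffices h : bernoulli' i ∈ pIntegralRat p by
    rw [bernoulli]
    exact mul_mem (pow_mem (neg_mem (one_mem _)) _) h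
  induction i using Nat.strong_induction_on with
  | _ i ih =>
    rw [bernoulli'_def]
    refine sub_mem (one_mem _) (sum_mem fun k hk => mul_mem ?_ (ih k ?_ ?_))
    · have hk := Finset.mem_range.1 hk
      have : (i : ℚ) - k + 1 = ((i - k + 1 : ℕ) : ℚ) := by
        rw [Nat.cast_add, Nat.cast_sub hk.le, Nat.cast_one]
      rw [this]
      exact div_natCast_mem_pIntegralRat (natCast_mem _ _)
        (Nat.not_dvd_of_pos_of_lt (by omega) (by omega))
    · exact Finset.mem_range.1 hk
    · have := Finset.mem_range.1 hk
      omega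

/-- Faulhaber's formula modulo `p ^ 2`, divided by `p`. -/
theorem sum_range_pow_div_ratModEq_bernoulli {j : ℕ} (hj : j < p - 1) :
    RatModEq p ((∑ k ∈ Finset.range p, (k : ℚ) ^ j) / p) (bernoulli j) := by
  have hp0 : (p : ℚ) ≠ 0 := by exact_mod_cast hp.out.ne_zero
  have hj1 : ((j : ℚ) + 1) ≠ 0 := by positivity
  refine ⟨∑ i ∈ Finset.range j,
    bernoulli i * ((j + 1).choose i) * (p : ℚ) ^ (j - 1 - i) / ((j + 1 : ℕ) : ℚ), ?_, ?_⟩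
  · refine sum_mem fun i hi => div_natCast_mem_pIntegralRat ?_
      (Nat.not_dvd_of_pos_of_lt (by omega) (by omega))
    have := Finset.mem_range.1 hi
    exact mul_mem (mul_mem (bernoulli_mem_pIntegralRat (by omega)) (natCast_mem _ _))
      (pow_mem (natCast_mem _ _) _)
  · rw [sum_range_pow, Finset.sum_range_succ, add_div, Finset.sum_div, Finset.mul_sum]
    have : bernoulli j * ((j + 1).choose j) * (p : ℚ) ^ (j + 1 - j) / (j + 1) / p =
        bernoulli j := by
      rw [Nat.choose_succ_self_right, Nat.add_sub_cancel_left]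
      push_cast
      field_simp
    rw [this, add_sub_cancel_right]
    refine Finset.sum_congr rfl fun i hi => ?_
    have := Finset.mem_range.1 hi
    have e : j + 1 - i = j - 1 - i + 2 := by omega
    rw [e]
    push_cast
    field_simp
    ring

theorem dvd_sum_range_pow {j : ℕ} (hj : j < p - 1) :
    (p : ℤ) ∣ ∑ k ∈ Finset.range p, (k : ℤ) ^ j := by
  rw [← ZMod.intCast_zmod_eq_zero_iff_dvd]
  push_cast
  have h := FiniteField.sum_pow_lt_card_sub_one (ZMod p) j (by rwa [ZMod.card])
  rw [← h]
  refine Finset.sum_bij' (fun k _ => (k : ZMod p)) (fun x _ => x.val) (fun _ _ => Finset.mem_univ _)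
    (fun x _ => Finset.mem_range.2 x.val_lt)
    (fun k hk => ZMod.val_cast_of_lt (Finset.mem_range.1 hk))
    (fun x _ => ZMod.natCast_zmod_val x) (fun _ _ => rfl)

/-- By Newton's identity, since the power sums of exponent less than `p - 1` vanish modulo `p`. -/
theorem dvd_esymmRange {j : ℕ} (hj0 : 0 < j) (hj : j < p - 1) : (p : ℤ) ∣ esymmRange p j := by
  have h : (p : ℤ) ∣ (j : ℤ) * esymmRange p j := by
    rw [natCast_mul_esymmRange p j hj0]
    refine Dvd.dvd.mul_left (dvd_add (dvd_sum_range_pow hj)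
      (Finset.dvd_sum fun i hi => Dvd.dvd.mul_left (dvd_sum_range_pow ?_) _)) _
    have := Finset.mem_Ico.1 hi
    omega
  refine ((Nat.prime_iff_prime_int.1 hp.out).dvd_or_dvd h).resolve_left fun h => ?_
  exact Nat.not_dvd_of_pos_of_lt hj0 (by omega) (Int.natCast_dvd_natCast.1 h)

/-- All terms of Newton's identity but the power sum itself vanish modulo `p ^ 2`, so Faulhaber's
formula evaluates the Stirling number `[p, p - j]` modulo `p ^ 2`. -/
theorem natCast_mul_stirlingFirst_div_ratModEq {j : ℕ} (hj0 : 0 < j) (hj : j < p - 1)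
    (h2 : Even j) :
    RatModEq p (j * (Nat.stirlingFirst p (p - j) / p)) (-bernoulli j) := by
  have hp0 : (p : ℚ) ≠ 0 := by exact_mod_cast hp.out.ne_zero
  have hN := natCast_mul_esymmRange p j hj0
  have hdvd : (p : ℤ) * p ∣ ∑ i ∈ Finset.Ico 1 j,
      (-1) ^ i * esymmRange p i * ∑ k ∈ Finset.range p, (k : ℤ) ^ (j - i) := by
    refine Finset.dvd_sum fun i hi => ?_
    have := Finset.mem_Ico.1 hi
    exact mul_dvd_mul (Dvd.dvd.mul_left (dvd_esymmRange (by omega) (by omega)) _)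
      (dvd_sum_range_pow (by omega))
  obtain ⟨w, hw⟩ := hdvd
  rw [hw, esymmRange_eq_stirlingFirst (by omega), pow_succ, h2.neg_one_pow] at hN
  have hN' : (j : ℚ) * Nat.stirlingFirst p (p - j) =
      -(∑ k ∈ Finset.range p, (k : ℚ) ^ j + p * p * w) := by
    have := congrArg (Int.cast : ℤ → ℚ) hN
    push_cast at this
    rw [this]
    ring
  refine RatModEq.trans ?_ (sum_range_pow_div_ratModEq_bernoulli hj).neg
  refine ⟨-w, neg_mem (intCast_mem _ w), ?_⟩
  field_simp
  rw [hN']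
  ring

end

/-! ### Fleck's sum of order `p n` modulo a power of `p` -/

section

variable {p : ℕ} [hp : Fact p.Prime]

theorem dvd_neg_one_pow_mul_choose_sub_one {i : ℕ} (hi : i < p) :
    (p : ℤ) ∣ (-1) ^ i * ((p - 1).choose i : ℤ) - 1 := by
  induction i with
  | zero => simp
  | succ i ih =>
    have h : p.choose (i + 1) = (p - 1).choose i + (p - 1).choose (i + 1) := by
      rw [← Nat.choose_succ_succ, Nat.succ_eq_add_one, Nat.sub_add_cancel hp.out.one_le]
    have hd : (p : ℤ) ∣ (p.choose (i + 1) : ℤ) :=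
      Int.natCast_dvd_natCast.2 (hp.out.dvd_choose_self i.succ_ne_zero hi)
    have e : (-1) ^ (i + 1) * ((p - 1).choose (i + 1) : ℤ) - 1 =
        (-1) ^ (i + 1) * (p.choose (i + 1) : ℤ) + ((-1) ^ i * ((p - 1).choose i : ℤ) - 1) := by
      rw [h]
      push_cast
      ring
    rw [e]
    exact dvd_add (hd.mul_left _) (ih (by omega))

theorem fleckPolySeries_modEq_negLogDivX :
    PowerSeriesModEq p (p - 1) (fleckPolySeries p) negLogDivX := by
  intro i hi
  have hcop : ¬ p ∣ i + 1 := Nat.not_dvd_of_pos_of_lt i.succ_pos (by omega)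
  have hL : PowerSeries.coeff i negLogDivX = ((i + 1 : ℕ) : ℚ)⁻¹ := by
    rw [negLogDivX, PowerSeries.coeff_mk]
    push_cast
    rfl
  have hF : PowerSeries.coeff i (fleckPolySeries p) = ((fleckPoly p).coeff i : ℚ) := by
    simpa using coeff_fleckPolySeries_pow p 1 i
  rw [hL, hF]
  refine ⟨intCast_mem _ _, inv_natCast_mem_pIntegralRat hcop, RatModEq.of_mul_left hcop ?_⟩
  rw [mul_inv_cancel₀ (by positivity)]
  have h1 : (i + 1) * (p.choose (i + 1) / p) = (p - 1).choose i := by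
    apply Nat.eq_of_mul_eq_mul_left hp.out.pos
    have h2 := Nat.add_one_mul_choose_eq (p - 1) i
    rw [Nat.sub_add_cancel hp.out.one_le] at h2
    rw [h2, mul_left_comm, natCast_mul_choose_div hp.out hi, mul_comm]
  have h := RatModEq.of_dvd (p := p) (x := (i + 1 : ℕ) * (fleckPoly p).coeff i) (y := 1) (by
    rw [coeff_fleckPoly, if_pos hi, mul_left_comm, ← Nat.cast_mul, h1]
    exact dvd_neg_one_pow_mul_choose_sub_one (by omega))
  push_cast at h ⊢
  exact h

/-- A consequence of `i [X ^ i] h ^ p ≡ 0` modulo `p`. -/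
theorem fleckPolySeries_pow_prime_modEq_one : PowerSeriesModEq p p (fleckPolySeries p ^ p) 1 := by
  intro i hi
  rw [coeff_fleckPolySeries_pow, PowerSeries.coeff_one]
  refine ⟨intCast_mem _ _, by split_ifs <;> simp [one_mem, zero_mem], ?_⟩
  rcases Nat.eq_zero_or_pos i with rfl | hi0
  · rw [Polynomial.coeff_zero_eq_eval_zero, Polynomial.eval_pow,
      ← Polynomial.coeff_zero_eq_eval_zero, coeff_zero_fleckPoly hp.out.two_le, one_pow, if_pos rfl,
      Int.cast_one]
    exact RatModEq.refl 1
  · rw [if_neg hi0.ne']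
    have h := (Nat.prime_iff_prime_int.1 hp.out).dvd_or_dvd (dvd_mul_coeff_pow (fleckPoly p) p i)
    have h' := h.resolve_left fun h =>
      Nat.not_dvd_of_pos_of_lt hi0 hi (Int.natCast_dvd_natCast.1 h)
    simpa using RatModEq.of_dvd (p := p) (y := 0) (by rwa [sub_zero])

/-- In the expansion of `-log (1 - p X h)`, this coefficient belongs to the only term that survives
modulo `p`: by Frobenius and `h ≡ -log (1 - X) / X` it is a Stirling number, hence a Bernoulli
number. -/
theorem coeff_fleckPoly_pow_div_ratModEq {a j q : ℕ} (hj : 0 < j) (h2 : Even j)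
    (haj : a + 1 + j = p) (ha : 0 < a) :
    RatModEq p (-((fleckPoly p ^ (p * q + (a + 1))).coeff j : ℚ) / ((p * q + (a + 1) : ℕ) : ℚ))
      ((a.factorial : ℚ) / ((a : ℚ) + 1) * bernoulli j) := by
  have hp0 : (p : ℚ) ≠ 0 := by exact_mod_cast hp.out.ne_zero
  have hB : bernoulli j ∈ pIntegralRat p := bernoulli_mem_pIntegralRat (by omega)
  have hfac : ∀ k < p, ¬ p ∣ k.factorial := fun k hk h => by
    rw [hp.out.dvd_factorial] at h
    omega
  have ha1 : ¬ p ∣ a + 1 := Nat.not_dvd_of_pos_of_lt (by omega) (by omega)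
  have hE : ¬ p ∣ p * q + (a + 1) := by rwa [Nat.dvd_add_right (dvd_mul_right p q)]
  have hE0 : ((p * q + (a + 1) : ℕ) : ℚ) ≠ 0 := by positivity
  have hcoeff : RatModEq p ((fleckPoly p ^ (p * q + (a + 1))).coeff j : ℚ)
      (PowerSeries.coeff j (negLogDivX ^ (a + 1))) := by
    rw [← coeff_fleckPolySeries_pow, pow_add, pow_mul]
    have h1 : PowerSeriesModEq p (p - 1) ((fleckPolySeries p ^ p) ^ q) (1 ^ q) :=
      fun i hi => fleckPolySeries_pow_prime_modEq_one.pow q i (by omega)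
    have h := (h1.mul (fleckPolySeries_modEq_negLogDivX.pow (a + 1)) j (by omega)).2.2
    rwa [one_pow, one_mul] at h
  set w : ℚ := (Nat.stirlingFirst p (a + 1) : ℚ) / p with hw
  have hjw : RatModEq p (j * w) (-bernoulli j) := by
    have := natCast_mul_stirlingFirst_div_ratModEq (p := p) hj (by omega) h2
    rwa [show p - j = a + 1 by omega] at this
  have hwR : w ∈ pIntegralRat p := by
    have h := div_natCast_mem_pIntegralRat (k := j) (hjw.mem (neg_mem hB))
      (Nat.not_dvd_of_pos_of_lt hj (by omega))
    rwa [mul_div_cancel_left₀ _ (by positivity)] at h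
  have haw : RatModEq p (((a : ℚ) + 1) * w) (bernoulli j) := by
    have h1 : RatModEq p (((a : ℚ) + 1) * w) (-(j * w)) := by
      refine ⟨w, hwR, ?_⟩
      have : (p : ℚ) = a + 1 + j := by exact_mod_cast haj.symm
      rw [this]
      ring
    simpa using h1.trans hjw.neg
  -- Wilson's theorem disposes of the factor `(p - 1)!` of `p!`.
  have hwil : RatModEq p (((p - 1).factorial : ℕ) : ℚ) (-1) := by
    have h := (ZMod.intCast_zmod_eq_zero_iff_dvd (((p - 1).factorial : ℤ) - (-1)) p).1 (by
      push_cast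
      rw [ZMod.wilsons_lemma]
      ring)
    simpa using RatModEq.of_dvd h
  have hstir : RatModEq p (-PowerSeries.coeff j (negLogDivX ^ (a + 1)))
      (a.factorial * bernoulli j) := by
    refine RatModEq.of_mul_left (hfac (p - 1) (by have := hp.out.pos; omega)) ?_
    have e1 : (((p - 1).factorial : ℕ) : ℚ) * (-PowerSeries.coeff j (negLogDivX ^ (a + 1))) =
        (-(a.factorial : ℚ)) * (((a : ℚ) + 1) * w) := by
      have hpf : (p.factorial : ℚ) = p * ((p - 1).factorial : ℕ) := by
        exact_mod_cast (Nat.mul_factorial_pred hp.out.ne_zero).symm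
      have hf0 : (((p - 1).factorial : ℕ) : ℚ) ≠ 0 := by positivity
      rw [coeff_negLogDivX_pow, show j + (a + 1) = p by omega, hw, hpf, Nat.factorial_succ]
      push_cast
      field_simp
    rw [e1]
    have h3 := haw.mul_left (neg_mem (natCast_mem (pIntegralRat p) a.factorial))
    have h4 := (hwil.mul_left (mul_mem (natCast_mem (pIntegralRat p) a.factorial) hB)).symm
    have e5 : (a.factorial : ℚ) * bernoulli j * -1 = -(a.factorial : ℚ) * bernoulli j := by ring
    rw [e5, mul_comm _ (((p - 1).factorial : ℕ) : ℚ)] at h4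
    exact h3.trans h4
  refine RatModEq.of_mul_left hE ?_
  rw [mul_div_cancel₀ _ hE0]
  refine (hcoeff.neg.trans hstir).trans ?_
  have e2 : ((a.factorial : ℚ) / ((a : ℚ) + 1) * bernoulli j) ∈ pIntegralRat p := by
    refine mul_mem ?_ hB
    rw [← Nat.cast_succ]
    exact div_natCast_mem_pIntegralRat (natCast_mem _ _) ha1
  refine RatModEq.symm ⟨q * _, mul_mem (natCast_mem _ q) e2, ?_⟩
  push_cast
  field_simp
  ring

theorem sub_one_mul_succ_le_pow {p i : ℕ} (hp : 3 ≤ p) (hi : 2 ≤ i) :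
    (p - 1) * (i + 1) ≤ p ^ i := by
  obtain ⟨s, rfl⟩ : ∃ s, p = s + 3 := ⟨p - 3, by omega⟩
  rw [show s + 3 - 1 = s + 2 by omega]
  induction i, hi using Nat.le_induction with
  | base => nlinarith
  | succ i hi ih =>
    rw [pow_succ]
    refine le_trans ?_ (Nat.mul_le_mul_right (s + 3) ih)
    rw [mul_assoc]
    exact Nat.mul_le_mul_left _ (by nlinarith)

/-- For `i = 1` the only multiple of `p` that `J = 2 (p - 1) - a` could be is `p` itself, which
`a ≤ p - 3` excludes; for `i ≥ 2` already `J < p ^ i`. -/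
theorem not_pow_dvd_of_add_eq {p i J a : ℕ} (ha : 2 ≤ a) (ha' : a + 3 ≤ p) (hi : 1 ≤ i)
    (h : J + a = (p - 1) * (i + 1)) : ¬ p ^ i ∣ J := by
  intro hd
  have hJ : 0 < J := by
    have : (p - 1) * 1 ≤ (p - 1) * (i + 1) := Nat.mul_le_mul_left _ (by omega)
    omega
  rcases hi.eq_or_lt with rfl | hi
  · obtain ⟨c, hc⟩ := hd
    rw [pow_one] at hc
    have hc1 : c < 2 := by
      by_contra hcon
      have : p * 2 ≤ p * c := Nat.mul_le_mul_left _ (by omega)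
      omega
    interval_cases c <;> omega
  · have h1 := Nat.le_of_dvd hJ hd
    have h2 := sub_one_mul_succ_le_pow (p := p) (by omega) hi
    omega

/-- `a` and `q` are the remainder and the quotient of `n` by `p - 1`, and `n + q` is the exponent
`⌊(p n - 1) / (p - 1)⌋` in the Fleck quotient. -/
theorem fleckSum_prime_mul_div_ratModEq {n a q : ℕ} (hn : n = (p - 1) * q + a) (ha : 2 ≤ a)
    (ha' : a + 3 ≤ p) (h2 : Even a) (hodd : Odd p) :
    RatModEq p ((fleckSum p (p * n) 0 : ℚ) / (p * n * (-(p : ℚ)) ^ (n + q)))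
      ((a.factorial : ℚ) / ((a : ℚ) + 1) * bernoulli (p - 1 - a)) := by
  have hp0 : (p : ℚ) ≠ 0 := by exact_mod_cast hp.out.ne_zero
  have hn0 : (n : ℚ) ≠ 0 := by
    have : n ≠ 0 := by omega
    exact_mod_cast this
  have hN : 0 < p * n := Nat.mul_pos hp.out.pos (by omega)
  have hsum := fleckSum_zero_eq_sum hp.out hodd hN
  set c : ℕ → ℚ := fun m => ((fleckPoly p ^ m).coeff (p * n - m) : ℚ) with hc
  have hV : (fleckSum p (p * n) 0 : ℚ) / (p * n * (-(p : ℚ)) ^ (n + q)) =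
      ∑ m ∈ Finset.Icc 1 (p * n), (-1) ^ (n + q) * ((p : ℚ) ^ m / p ^ (n + q + 1)) * (c m / m) := by
    have hsq : ((-1 : ℚ) ^ (n + q)) * (-1) ^ (n + q) = 1 := by rw [← mul_pow]; norm_num
    rw [div_eq_iff (mul_ne_zero (mul_ne_zero hp0 hn0) (pow_ne_zero _ (neg_ne_zero.2 hp0))),
      Finset.sum_mul]
    apply mul_left_cancel₀ hp0
    rw [hsum, Finset.mul_sum, Finset.mul_sum]
    refine Finset.sum_congr rfl fun m hm => ?_
    have hm0 : (m : ℚ) ≠ 0 := by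
      have := (Finset.mem_Icc.1 hm).1
      positivity
    rw [neg_pow (p : ℚ), hc]
    push_cast
    field_simp
    linear_combination
      (-(((fleckPoly p ^ m).coeff (p * n - m) : ℤ) : ℚ) * (p : ℚ) ^ (n + q + 1)) * hsq
  obtain ⟨t, ht⟩ : ∃ t, p = t + 2 := ⟨p - 2, by omega⟩
  have hp1 : p - 1 = t + 1 := by omega
  -- The exponents `p n - m` and `J` are exchanged by the symmetry of the coefficients of `h ^ m`.
  have hJ : ∀ i J, n + q + 1 + i ≤ p * n → J + a = (p - 1) * (i + 1) →
      c (n + q + 1 + i) = (-1) ^ (n + q + 1 + i) *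
        (((fleckPoly p ^ (n + q + 1 + i)).coeff J : ℤ) : ℚ) := by
    intro i J hi hJ
    have h1 : p * n + J = (p - 1) * (n + q + 1 + i) := by
      rw [hp1] at hJ hn ⊢
      rw [hn, ht]
      linear_combination hJ
    have h2 : p * n - (n + q + 1 + i) + J = (p - 2) * (n + q + 1 + i) := by
      have : (p - 1) * (n + q + 1 + i) = (p - 2) * (n + q + 1 + i) + (n + q + 1 + i) := by
        rw [hp1, show p - 2 = t by omega]
        ring
      omega
    simp only [hc]
    rw [coeff_fleckPoly_pow_symm hp.out.two_le hodd h2]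
    push_cast
    rfl
  have hmem : n + q + 1 ∈ Finset.Icc 1 (p * n) := by
    refine Finset.mem_Icc.2 ⟨by omega, ?_⟩
    have h1 : q ≤ (p - 1) * q := Nat.le_mul_of_pos_left q (by omega)
    have h2 : 3 * n ≤ p * n := Nat.mul_le_mul_right n (by omega)
    omega
  rw [hV]
  have hterm : ∀ m ∈ Finset.Icc 1 (p * n), RatModEq p
      ((-1) ^ (n + q) * ((p : ℚ) ^ m / p ^ (n + q + 1)) * (c m / m))
      (if m = n + q + 1 then (a.factorial : ℚ) / ((a : ℚ) + 1) * bernoulli (p - 1 - a) else 0) := by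
    intro m hm
    rcases lt_trichotomy m (n + q + 1) with h | rfl | h
    · have h0 : c m = 0 := by
        simp only [hc]
        rw [coeff_fleckPoly_pow_eq_zero, Int.cast_zero]
        have h1 : (t + 1) * m ≤ (t + 1) * (n + q) := Nat.mul_le_mul_left _ (by omega)
        have h3 : (t + 1) * (n + q) + a = p * n := by
          rw [hp1] at hn
          rw [ht, hn]
          ring
        rw [show p - 2 = t by omega]
        have h4 : (t + 1) * m = t * m + m := by ring
        omega
      rw [h0, if_neg h.ne, zero_div, mul_zero]
      exact RatModEq.refl 0
    · have hE : n + q + 1 = p * q + (a + 1) := by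
        rw [hn, hp1, ht]
        ring
      rw [if_pos rfl]
      have h1 := hJ 0 (p - 1 - a) (Finset.mem_Icc.1 hm).2 (by omega)
      rw [add_zero] at h1
      have hjev : Even (p - 1 - a) := (Nat.even_sub (by omega)).2
        (iff_of_true (by obtain ⟨k, hk⟩ := hodd; exact ⟨k, by omega⟩) h2)
      have h3 := coeff_fleckPoly_pow_div_ratModEq (p := p) (a := a) (j := p - 1 - a) (q := q)
        (by omega) hjev (by omega) (by omega)
      rw [h1, div_self (pow_ne_zero _ hp0), mul_one, pow_succ]
      rw [← hE] at h3
      have hsq : ((-1 : ℚ) ^ (n + q)) * (-1) ^ (n + q) = 1 := by rw [← mul_pow]; norm_num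
      have e : (-1 : ℚ) ^ (n + q) * ((-1) ^ (n + q) * -1 *
          (((fleckPoly p ^ (n + q + 1)).coeff (p - 1 - a) : ℤ) : ℚ) / ((n + q + 1 : ℕ) : ℚ)) =
          -(((fleckPoly p ^ (n + q + 1)).coeff (p - 1 - a) : ℤ) : ℚ) / ((n + q + 1 : ℕ) : ℚ) := by
        linear_combination (-(((fleckPoly p ^ (n + q + 1)).coeff (p - 1 - a) : ℤ) : ℚ) /
          ((n + q + 1 : ℕ) : ℚ)) * hsq
      rw [e]
      exact h3
    · obtain ⟨i, rfl⟩ : ∃ i, m = n + q + 1 + (i + 1) := ⟨m - (n + q + 1) - 1, by omega⟩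
      rw [if_neg h.ne']
      obtain ⟨J, hJa⟩ : ∃ J, J + a = (p - 1) * (i + 1 + 1) := by
        have : (p - 1) * 1 ≤ (p - 1) * (i + 1 + 1) := Nat.mul_le_mul_left _ (by omega)
        exact ⟨(p - 1) * (i + 1 + 1) - a, by omega⟩
      have h1 := hJ (i + 1) J (Finset.mem_Icc.1 hm).2 hJa
      have hnd := not_pow_dvd_of_add_eq ha ha' (by omega) hJa
      obtain ⟨z, hz⟩ := dvd_mul_coeff_pow (fleckPoly p) (n + q + 1 + (i + 1)) J
      have hJ0 : (J : ℚ) ≠ 0 := by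
        intro h
        rw [Nat.cast_eq_zero.1 h] at hnd
        exact hnd (dvd_zero _)
      have hm0 : ((n + q + 1 + (i + 1) : ℕ) : ℚ) ≠ 0 := by positivity
      have hz' : (((fleckPoly p ^ (n + q + 1 + (i + 1))).coeff J : ℤ) : ℚ) /
          ((n + q + 1 + (i + 1) : ℕ) : ℚ) = z / J := by
        rw [div_eq_div_iff hm0 hJ0]
        have := congrArg (Int.cast : ℤ → ℚ) hz
        push_cast at this ⊢
        linear_combination this
      refine ⟨(-1) ^ (n + q) * (-1) ^ (n + q + 1 + (i + 1)) * ((p : ℚ) ^ i / J) * z, ?_, ?_⟩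
      · exact mul_mem (mul_mem (mul_mem (pow_mem (neg_mem (one_mem _)) _)
          (pow_mem (neg_mem (one_mem _)) _)) (pow_div_mem_pIntegralRat hnd)) (intCast_mem _ z)
      · rw [h1, mul_div_assoc, hz', pow_add (p : ℚ) (n + q + 1) (i + 1),
          mul_div_cancel_left₀ _ (pow_ne_zero _ hp0), sub_zero]
        ring
  have h := RatModEq.sum hterm
  rwa [Finset.sum_ite_eq' (Finset.Icc 1 (p * n)) (n + q + 1), if_pos hmem] at h

end

/-! ### Fleck's sums over the multiples of `p` -/

theorem fleckSum_zero_eq_sum_range {p : ℕ} (hodd : Odd p) {N n : ℕ} (h : N < p * n) :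
    fleckSum p N 0 = ∑ k ∈ Finset.range n, (N.choose (p * k) : ℤ) * (-1) ^ k := by
  have hp0 : 0 < p := hodd.pos
  have h1 : fleckSum p N 0 = ∑ k ∈ Finset.range (p * n),
      if p ∣ k then (N.choose k : ℤ) * (-1) ^ k else 0 := by
    rw [fleckSum_eq_sum_ite]
    simp only [sub_zero, Int.natCast_dvd_natCast]
    refine Finset.sum_subset (Finset.range_subset_range.2 h) fun k _ hk => ?_
    rw [Nat.choose_eq_zero_of_lt (by simpa using hk)]
    simp
  have h2 : (Finset.range (p * n)).filter (p ∣ ·) = (Finset.range n).image (p * ·) := by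
    ext k
    simp only [Finset.mem_filter, Finset.mem_range, Finset.mem_image]
    constructor
    · rintro ⟨hk, l, rfl⟩
      exact ⟨l, Nat.lt_of_mul_lt_mul_left hk, rfl⟩
    · rintro ⟨l, hl, rfl⟩
      exact ⟨Nat.mul_lt_mul_of_pos_left hl hp0, dvd_mul_right _ _⟩
  rw [h1, ← Finset.sum_filter, h2,
    Finset.sum_image fun _ _ _ _ h => Nat.eq_of_mul_eq_mul_left hp0 h]
  refine Finset.sum_congr rfl fun k _ => ?_
  rw [pow_mul, hodd.neg_one_pow]

/-- The symmetry `k ↦ n - k`. -/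
theorem sum_Icc_choose_sub_one_eq_fleckSum {p : ℕ} (hodd : Odd p) {n : ℕ} (hn : 0 < n)
    (h2 : Even n) :
    ∑ k ∈ Finset.Icc 1 n, ((p * n - 1).choose (p * k - 1) : ℤ) * (-1) ^ k =
      fleckSum p (p * n - 1) 0 := by
  have hp0 : 0 < p := hodd.pos
  have hN : 0 < p * n := Nat.mul_pos hp0 hn
  rw [fleckSum_zero_eq_sum_range hodd (n := n) (by omega)]
  refine Finset.sum_bij' (fun k _ => n - k) (fun k _ => n - k) ?_ ?_ ?_ ?_ ?_
  · intro k hk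
    have := Finset.mem_Icc.1 hk
    exact Finset.mem_range.2 (by omega)
  · intro k hk
    have := Finset.mem_range.1 hk
    exact Finset.mem_Icc.2 (by omega)
  · intro k hk
    have := Finset.mem_Icc.1 hk
    omega
  · intro k hk
    have := Finset.mem_range.1 hk
    omega
  · intro k hk
    obtain ⟨hk1, hkn⟩ := Finset.mem_Icc.1 hk
    have hle : p * k ≤ p * n := Nat.mul_le_mul_left p hkn
    have hpos : 0 < p * k := Nat.mul_pos hp0 hk1
    rw [← Nat.choose_symm (by omega : p * k - 1 ≤ p * n - 1),
      show p * n - 1 - (p * k - 1) = p * (n - k) by rw [Nat.mul_sub]; omega]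
    congr 1
    have h : (-1 : ℤ) ^ (n - k) * (-1) ^ k = 1 := by
      rw [← pow_add, Nat.sub_add_cancel hkn, h2.neg_one_pow]
    have h' : (-1 : ℤ) ^ k * (-1) ^ k = 1 := by rw [← mul_pow]; norm_num
    linear_combination (-1) ^ (n - k) * h' - (-1) ^ k * h

/-- Pascal's rule splits the left-hand side into two sums that are exchanged by `k ↦ n - k`. -/
theorem fleckSum_mul_eq_two_mul {p : ℕ} (hodd : Odd p) {n : ℕ} (hn : 0 < n) (h2 : Even n) :
    fleckSum p (p * n) 0 = 2 * fleckSum p (p * n - 1) 0 := by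
  have hp0 : 0 < p := hodd.pos
  have hN : 0 < p * n := Nat.mul_pos hp0 hn
  have h1 : p * n < p * (n + 1) := Nat.mul_lt_mul_of_pos_left n.lt_succ_self hp0
  have h3 := sum_Icc_choose_sub_one_eq_fleckSum hodd hn h2
  have h4 := fleckSum_zero_eq_sum_range hodd (N := p * n - 1) (n := n + 1) (by omega)
  rw [Finset.sum_range_succ'] at h4
  rw [← Finset.Ico_add_one_right_eq_Icc, ← zero_add 1, ← Finset.sum_Ico_add', ← Finset.range_eq_Ico]
    at h3
  rw [two_mul, fleckSum_zero_eq_sum_range hodd h1, Finset.sum_range_succ']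
  nth_rewrite 1 [← h3]
  rw [h4, ← add_assoc, ← Finset.sum_add_distrib]
  congr 1
  · refine Finset.sum_congr rfl fun k _ => ?_
    rw [← add_mul, ← Nat.cast_add]
    congr 2
    have hpos : 0 < p * (k + 1) := Nat.mul_pos hp0 k.succ_pos
    obtain ⟨A, hA⟩ := Nat.exists_eq_add_of_lt hN
    obtain ⟨B, hB⟩ := Nat.exists_eq_add_of_lt hpos
    rw [zero_add] at hA hB
    rw [hA, hB, Nat.add_sub_cancel, Nat.add_sub_cancel, Nat.choose_succ_succ]
  · simp

/-! ### Stirling numbers of the second kind -/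

theorem factorial_mul_stirlingSecond (N k : ℕ) :
    (k.factorial : ℤ) * (Nat.stirlingSecond N k : ℤ) =
      ∑ i ∈ Finset.range (k + 1), (-1) ^ (k + i) * (k.choose i : ℤ) * (i : ℤ) ^ N := by
  induction N generalizing k with
  | zero =>
    have h := Int.alternating_sum_range_choose (n := k)
    have : ∑ i ∈ Finset.range (k + 1), (-1 : ℤ) ^ (k + i) * (k.choose i : ℤ) * (i : ℤ) ^ 0 =
        (-1) ^ k * ∑ i ∈ Finset.range (k + 1), (-1 : ℤ) ^ i * (k.choose i : ℤ) := by
      rw [Finset.mul_sum]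
      exact Finset.sum_congr rfl fun i _ => by ring
    rw [this, h]
    cases k with
    | zero => simp
    | succ k => simp
  | succ N ih =>
    cases k with
    | zero => simp
    | succ k =>
      have e1 := ih (k + 1)
      have e2 := ih k
      have e3 : ∑ i ∈ Finset.range (k + 1), (-1 : ℤ) ^ (k + i) * (k.choose i : ℤ) * (i : ℤ) ^ N =
          ∑ i ∈ Finset.range (k + 1 + 1), (-1 : ℤ) ^ (k + i) * (k.choose i : ℤ) * (i : ℤ) ^ N := by
        rw [Finset.sum_range_succ _ (k + 1)]
        simp
      rw [e3] at e2
      have e4 : ∑ i ∈ Finset.range (k + 1 + 1),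
            (-1 : ℤ) ^ (k + 1 + i) * ((k + 1).choose i : ℤ) * (i : ℤ) ^ (N + 1) =
          (k + 1) * (∑ i ∈ Finset.range (k + 1 + 1),
              (-1 : ℤ) ^ (k + 1 + i) * ((k + 1).choose i : ℤ) * (i : ℤ) ^ N +
            ∑ i ∈ Finset.range (k + 1 + 1),
              (-1 : ℤ) ^ (k + i) * (k.choose i : ℤ) * (i : ℤ) ^ N) := by
        rw [← Finset.sum_add_distrib, Finset.mul_sum, Finset.sum_range_succ',
          Finset.sum_range_succ' _ (k + 1)]
        congr 1
        · refine Finset.sum_congr rfl fun i _ => ?_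
          have h1 : ((k : ℤ) + 1) * (k.choose i : ℤ) = ((k + 1).choose (i + 1) : ℤ) * (i + 1) := by
            exact_mod_cast Nat.add_one_mul_choose_eq k i
          have h2 : ((k + 1).choose (i + 1) : ℤ) = k.choose i + k.choose (i + 1) := by
            exact_mod_cast Nat.choose_succ_succ k i
          push_cast
          rw [pow_succ ((i : ℤ) + 1) N]
          linear_combination (-(-1) ^ (k + i) * ((i : ℤ) + 1) ^ N) * h1 -
            (-1) ^ (k + i) * ((i : ℤ) + 1) ^ N * ((k : ℤ) + 1) * h2
        · simp only [Nat.choose_zero_right, Nat.cast_zero, Nat.cast_one, pow_succ]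
          ring
      rw [e4, ← e1, ← e2, Nat.stirlingSecond_succ_succ, Nat.factorial_succ]
      push_cast
      ring

/-- For a multiple `M` of `φ(p ^ b)`, the power `i ^ M` is modulo `p ^ b` the indicator of `p ∤ i`,
which turns the explicit formula for Stirling numbers into Fleck's sum. -/
theorem pow_dvd_factorial_mul_stirlingSecond_add {p : ℕ} (hp : p.Prime) {b m k : ℕ} (hb : 0 < b)
    (hm : 0 < m) (hk : 0 < k) :
    (p : ℤ) ^ b ∣ (k.factorial : ℤ) * (Nat.stirlingSecond (m * Nat.totient (p ^ b)) k : ℤ) +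
      (-1) ^ k * fleckSum p k 0 := by
  have hM : b ≤ m * Nat.totient (p ^ b) := by
    rw [Nat.totient_prime_pow hp hb]
    have h1 : b - 1 < p ^ (b - 1) := Nat.lt_pow_self hp.one_lt
    have h2 : p ^ (b - 1) * 1 ≤ p ^ (b - 1) * (p - 1) :=
      Nat.mul_le_mul_left _ (by have := hp.two_le; omega)
    have h3 : 1 * (p ^ (b - 1) * (p - 1)) ≤ m * (p ^ (b - 1) * (p - 1)) := Nat.mul_le_mul_right _ hm
    omega
  have hpow : ∀ i : ℕ, (p : ℤ) ^ b ∣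
      (i : ℤ) ^ (m * Nat.totient (p ^ b)) - (1 - if (p : ℤ) ∣ (i : ℤ) - 0 then 1 else 0) := by
    intro i
    simp only [sub_zero, Int.natCast_dvd_natCast]
    by_cases hi : p ∣ i
    · rw [if_pos hi, sub_self, sub_zero]
      exact (pow_dvd_pow _ hM).trans (pow_dvd_pow_of_dvd (Int.natCast_dvd_natCast.2 hi) _)
    · rw [if_neg hi, sub_zero]
      have h := Nat.ModEq.pow m (Nat.ModEq.pow_totient (x := i) (n := p ^ b)
        (Nat.Coprime.pow_right b ((hp.coprime_iff_not_dvd.2 hi).symm)))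
      rw [one_pow, ← pow_mul, mul_comm] at h
      have := (Nat.modEq_iff_dvd.1 h.symm)
      push_cast at this
      exact this
  have halt : ∑ i ∈ Finset.range (k + 1), (-1 : ℤ) ^ (k + i) * (k.choose i : ℤ) = 0 := by
    have h := Int.alternating_sum_range_choose_of_ne hk.ne'
    have : ∑ i ∈ Finset.range (k + 1), (-1 : ℤ) ^ (k + i) * (k.choose i : ℤ) =
        (-1) ^ k * ∑ i ∈ Finset.range (k + 1), (-1 : ℤ) ^ i * (k.choose i : ℤ) := by
      rw [Finset.mul_sum]
      exact Finset.sum_congr rfl fun i _ => by ring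
    rw [this, h, mul_zero]
  have e : (k.factorial : ℤ) * (Nat.stirlingSecond (m * Nat.totient (p ^ b)) k : ℤ) +
      (-1) ^ k * fleckSum p k 0 = ∑ i ∈ Finset.range (k + 1), (-1) ^ (k + i) * (k.choose i : ℤ) *
        ((i : ℤ) ^ (m * Nat.totient (p ^ b)) -
          (1 - if (p : ℤ) ∣ (i : ℤ) - 0 then 1 else 0)) := by
    refine (sub_zero _).symm.trans ((congrArg (HSub.hSub _) halt.symm).trans ?_)
    rw [factorial_mul_stirlingSecond, fleckSum_eq_sum_ite, Finset.mul_sum,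
      ← Finset.sum_add_distrib, ← Finset.sum_sub_distrib]
    refine Finset.sum_congr rfl fun i _ => ?_
    split_ifs <;> ring
  rw [e]
  exact Finset.dvd_sum fun i _ => (hpow i).mul_left _

/-! ### The congruences for Stirling numbers -/

section

variable {p : ℕ} [hp : Fact p.Prime]

/-- The bound on `b` leaves the factor `p ^ (n + 1)` of `z` to beat the valuation of `p n`. -/
theorem ratModEq_zero_of_pow_dvd {n q b : ℕ} {z : ℤ} (hn : 0 < n) (hb : 2 * (n + q) < b)
    (hz : (p : ℤ) ^ b ∣ z) :
    RatModEq p ((z : ℚ) / (p * n * (-(p : ℚ)) ^ (n + q))) 0 := by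
  obtain ⟨w, rfl⟩ := hz
  obtain ⟨l, rfl⟩ : ∃ l, b = n + q + l + 2 := ⟨b - (n + q) - 2, by omega⟩
  have hp0 : (p : ℚ) ≠ 0 := by exact_mod_cast hp.out.ne_zero
  have hn0 : (n : ℚ) ≠ 0 := by exact_mod_cast hn.ne'
  have hnd : ¬ p ^ (l + 1) ∣ n := fun h => by
    have h1 := Nat.le_of_dvd hn h
    have h2 : l + 1 < p ^ (l + 1) := Nat.lt_pow_self hp.out.one_lt
    omega
  have hsq : ((-1 : ℚ) ^ (n + q)) * (-1) ^ (n + q) = 1 := by rw [← mul_pow]; norm_num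
  refine ⟨(-1) ^ (n + q) * ((p : ℚ) ^ l / n) * w, mul_mem (mul_mem
    (pow_mem (neg_mem (one_mem _)) _) (pow_div_mem_pIntegralRat hnd)) (intCast_mem _ w), ?_⟩
  rw [sub_zero, div_eq_iff (mul_ne_zero (mul_ne_zero hp0 hn0) (pow_ne_zero _ (neg_ne_zero.2 hp0))),
    neg_pow (p : ℚ)]
  push_cast
  field_simp
  linear_combination (-(p : ℚ) ^ (n + q + l + 2) * (w : ℚ)) * hsq

variable {n q b m : ℕ}

theorem stirlingSecond_sub_one_ratModEq_fleckSum (hodd : Odd p) (hn : 0 < n) (h2 : Even n)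
    (hm : 0 < m) (hb : 2 * (n + q) < b) :
    RatModEq p (2 / ((p : ℚ) * (n : ℚ)) * ((((p * n - 1).factorial : ℚ)
        * (Nat.stirlingSecond (m * Nat.totient (p ^ b)) (p * n - 1) : ℚ)) /
          (-(p : ℚ)) ^ (n + q)))
      ((fleckSum p (p * n) 0 : ℚ) / (p * n * (-(p : ℚ)) ^ (n + q))) := by
  have hN : 2 ≤ p * n := Nat.mul_le_mul hp.out.two_le hn
  have hd := pow_dvd_factorial_mul_stirlingSecond_add hp.out (b := b) (m := m) (k := p * n - 1)
    (by omega) hm (by omega)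
  rw [Odd.neg_one_pow (Nat.Even.sub_odd (by omega) (h2.mul_left p) odd_one)] at hd
  obtain ⟨z, hz, e⟩ := ratModEq_zero_of_pow_dvd hn hb (hd.mul_left 2)
  refine ⟨z, hz, ?_⟩
  rw [← e, fleckSum_mul_eq_two_mul hodd hn h2]
  push_cast
  ring

theorem stirlingSecond_ratModEq_fleckSum (hn : 0 < n) (h2 : Even n)
    (hm : 0 < m) (hb : 2 * (n + q) < b) :
    RatModEq p (-((((p * n - 1).factorial : ℚ)
        * (Nat.stirlingSecond (m * Nat.totient (p ^ b)) (p * n) : ℚ)) / (-(p : ℚ)) ^ (n + q)))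
      ((fleckSum p (p * n) 0 : ℚ) / (p * n * (-(p : ℚ)) ^ (n + q))) := by
  have hp0 : (p : ℚ) ≠ 0 := by exact_mod_cast hp.out.ne_zero
  have hn0 : (n : ℚ) ≠ 0 := by exact_mod_cast hn.ne'
  have hN : 0 < p * n := Nat.mul_pos hp.out.pos hn
  have hd := pow_dvd_factorial_mul_stirlingSecond_add hp.out (b := b) (m := m) (k := p * n)
    (by omega) hm hN
  rw [(h2.mul_left p).neg_one_pow, ← Nat.mul_factorial_pred hN.ne', one_mul] at hd
  obtain ⟨z, hz, e⟩ := (ratModEq_zero_of_pow_dvd hn hb hd).neg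
  refine ⟨z, hz, ?_⟩
  rw [← e]
  push_cast
  field_simp
  ring

end

/-! ### The floors in the exponents and the irregular prime `37` -/

theorem int_ediv_eq {x d c r : ℤ} (h : x = d * c + r) (h0 : 0 ≤ r) (hr : r < d) : x / d = c := by
  rw [h, add_comm, Int.add_mul_ediv_left _ _ (by omega), Int.ediv_eq_zero_of_lt h0 hr, zero_add]

/-- `37` divides the numerator of `B_32`, and accordingly the Fleck quotient `F_37(148, 0) / 148`
vanishes modulo `37`. -/
theorem fleckSum_thirtySeven_ratModEq_zero [Fact (Nat.Prime 37)] :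
    RatModEq 37 ((fleckSum 37 (37 * 4) 0 : ℚ) /
      (((37 : ℕ) : ℚ) * ((4 : ℕ) : ℚ) * (-((37 : ℕ) : ℚ)) ^ (4 + 0))) 0 := by
  have h : (37 : ℤ) ^ 6 ∣ fleckSum 37 (37 * 4) 0 := by
    rw [fleckSum_zero_eq_sum_range (n := 5) (by decide) (by norm_num)]
    simp only [Finset.sum_range_succ, Finset.sum_range_zero]
    norm_num [Nat.choose]
  obtain ⟨w, hw⟩ := h
  refine ⟨(w : ℚ) / (4 : ℕ), intCast_div_mem_pIntegralRat (by norm_num), ?_⟩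
  rw [hw]
  push_cast
  ring

theorem theorem1p2 :
    -- the congruences
    (∀ (p : ℕ) [Fact p.Prime] (n : ℕ), p ≠ 2 → 0 < n → 2 ∣ n → ¬ (p - 1) ∣ n →
      (2 * ∑ k ∈ Finset.Icc 1 n, ((p * n - 1).choose (p * k - 1) : ℚ) * (-1) ^ k)
          / ((-(p : ℚ)) ^ (((n : ℤ) - 2) / ((p : ℤ) - 1)) * (p : ℚ) ^ (n + 1) * (n : ℚ))
        = fleckQuotient p (p * n) 0 / ((p : ℚ) * (n : ℚ)) ∧
      PadicIntCongr p
        (fleckQuotient p (p * n) 0 / ((p : ℚ) * (n : ℚ)))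
        (((leastPosResidue n (p - 1)).factorial : ℚ) / ((leastPosResidue n (p - 1) : ℚ) + 1)
          * bernoulli (p - 1 - leastPosResidue n (p - 1))) ∧
      ∀ b m : ℕ, 0 < b → 0 < m →
        2 * (((p : ℤ) * n - 1) / ((p : ℤ) - 1)) < (b : ℤ) →
        PadicIntCongr p
          (2 / ((p : ℚ) * (n : ℚ)) *
            ((((p * n - 1).factorial : ℚ)
                * (Nat.stirlingSecond (m * Nat.totient (p ^ b)) (p * n - 1) : ℚ))
              / (-(p : ℚ)) ^ (((p : ℤ) * n - 2) / ((p : ℤ) - 1))))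
          (-((((p * n - 1).factorial : ℚ)
                * (Nat.stirlingSecond (m * Nat.totient (p ^ b)) (p * n) : ℚ))
              / (-(p : ℚ)) ^ (((p : ℤ) * n - 1) / ((p : ℤ) - 1)))) ∧
        PadicIntCongr p
          (-((((p * n - 1).factorial : ℚ)
                * (Nat.stirlingSecond (m * Nat.totient (p ^ b)) (p * n) : ℚ))
              / (-(p : ℚ)) ^ (((p : ℤ) * n - 1) / ((p : ℤ) - 1))))
          (((leastPosResidue n (p - 1)).factorial : ℚ) / ((leastPosResidue n (p - 1) : ℚ) + 1)
            * bernoulli (p - 1 - leastPosResidue n (p - 1)))) ∧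
    -- failure of the Gessel–Lengyel conjecture, which asserts that for all such `p` and `n`
    -- equality holds in both lines in place of the strict inequality
    (∃ p n : ℕ, p.Prime ∧ p ≠ 2 ∧ 0 < n ∧ 2 ∣ n ∧ ¬ (p - 1) ∣ n ∧
      ∀ b m : ℕ, 0 < b → 0 < m → 2 * ((p * n - 1) / (p - 1)) < b →
        (((p * n - 2) / (p - 1) + padicValNat p (p * n) : ℕ) : ℕ∞)
          < emultiplicity p ((p * n - 1).factorial
              * Nat.stirlingSecond (m * Nat.totient (p ^ b)) (p * n - 1)) ∧
        (((p * n - 1) / (p - 1) + padicValNat p (p * n) : ℕ) : ℕ∞)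
          < emultiplicity p ((p * n).factorial
              * Nat.stirlingSecond (m * Nat.totient (p ^ b)) (p * n))) := by
  refine ⟨?_, ?_⟩
  · intro p hp n hp2 hn h2 hd
    have hodd : Odd p := hp.out.odd_of_ne_two hp2
    have hn2 : Even n := even_iff_two_dvd.2 h2
    have hp2le := hp.out.two_le
    obtain ⟨t, ht⟩ := hodd
    set a := n % (p - 1) with ha
    set q := n / (p - 1) with hq
    have hnq : n = (p - 1) * q + a := (Nat.div_add_mod n (p - 1)).symm
    have ha0 : a ≠ 0 := fun h => hd (Nat.dvd_of_mod_eq_zero h)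
    have halt : a < p - 1 := Nat.mod_lt _ (by omega)
    have haev : Even a := by
      have h : Even ((p - 1) * q) := Even.mul_right ⟨t, by omega⟩ q
      rw [hnq] at hn2
      exact (Nat.even_add.1 hn2).1 h
    obtain ⟨s, hs⟩ := id haev
    have hlpr : leastPosResidue n (p - 1) = a := by rw [leastPosResidue, if_neg ha0]
    have hp0 : (p : ℚ) ≠ 0 := by exact_mod_cast hp.out.ne_zero
    have hn0 : (n : ℚ) ≠ 0 := by exact_mod_cast hn.ne'
    have hnZ : (n : ℤ) = ((p : ℤ) - 1) * q + a := by
      have := congrArg (Nat.cast : ℕ → ℤ) hnq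
      push_cast [Nat.cast_sub hp.out.one_le] at this
      exact this
    -- Since `2 ≤ a ≤ p - 3`, subtracting `1` or `2` does not cross a multiple of `p - 1`.
    have f1 : ((p : ℤ) * n - 1) / ((p : ℤ) - 1) = ((n + q : ℕ) : ℤ) :=
      int_ediv_eq (r := (a : ℤ) - 1) (by push_cast; linear_combination hnZ) (by omega) (by omega)
    have f2 : ((p : ℤ) * n - 2) / ((p : ℤ) - 1) = ((n + q : ℕ) : ℤ) :=
      int_ediv_eq (r := (a : ℤ) - 2) (by push_cast; linear_combination hnZ) (by omega) (by omega)
    have f3 : ((n : ℤ) - 2) / ((p : ℤ) - 1) = (q : ℤ) :=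
      int_ediv_eq (r := (a : ℤ) - 2) (by linear_combination hnZ) (by omega) (by omega)
    have hV : fleckQuotient p (p * n) 0 / ((p : ℚ) * (n : ℚ)) =
        (fleckSum p (p * n) 0 : ℚ) / (p * n * (-(p : ℚ)) ^ (n + q)) := by
      have hpn : p * n ≠ 0 := Nat.mul_ne_zero hp.out.ne_zero hn.ne'
      rw [fleckQuotient, fleckExponent, Nat.cast_mul, f1, if_neg hpn, add_zero, zpow_neg,
        zpow_natCast]
      field_simp
    have hmain := fleckSum_prime_mul_div_ratModEq (p := p) hnq (by omega) (by omega) haev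
      (hp.out.odd_of_ne_two hp2)
    have hc : (a.factorial : ℚ) / ((a : ℚ) + 1) * bernoulli (p - 1 - a) ∈ pIntegralRat p := by
      refine mul_mem ?_ (bernoulli_mem_pIntegralRat (by omega))
      rw [← Nat.cast_succ]
      exact div_natCast_mem_pIntegralRat (natCast_mem _ _)
        (Nat.not_dvd_of_pos_of_lt a.succ_pos (by omega))
    rw [hlpr, f1, f2, f3, hV, zpow_natCast, zpow_natCast]
    refine ⟨?_, hmain.padicIntCongr hc, ?_⟩
    · have h3 := sum_Icc_choose_sub_one_eq_fleckSum (hp.out.odd_of_ne_two hp2) hn hn2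
      have h4 : (∑ k ∈ Finset.Icc 1 n, ((p * n - 1).choose (p * k - 1) : ℚ) * (-1) ^ k) =
          (fleckSum p (p * n - 1) 0 : ℚ) := by
        rw [← h3]
        push_cast
        rfl
      rw [h4, fleckSum_mul_eq_two_mul (hp.out.odd_of_ne_two hp2) hn hn2, pow_add _ n q,
        hn2.neg_pow]
      push_cast
      congr 1
      ring
    · intro b m _ hm hb
      have hb' : 2 * (n + q) < b := by exact_mod_cast hb
      have h1 := stirlingSecond_sub_one_ratModEq_fleckSum (p := p) (hp.out.odd_of_ne_two hp2)
        hn hn2 hm hb'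
      have h0 := stirlingSecond_ratModEq_fleckSum (p := p) hn hn2 hm hb'
      exact ⟨(h1.trans h0.symm).padicIntCongr ((h0.trans hmain).mem hc),
        (h0.trans hmain).padicIntCongr hc⟩
  · have hp : Nat.Prime 37 := by norm_num
    have : Fact (Nat.Prime 37) := ⟨hp⟩
    refine ⟨37, 4, hp, by norm_num, by norm_num, by norm_num, by norm_num, ?_⟩
    intro b m _ hm hb
    -- Here `a = 4` and `q = 0`, so both floors are `4`, and the right-hand sides are `4 + 1`.
    have hb' : 2 * (4 + 0) < b := by simpa using hb
    have hv : padicValNat 37 (37 * 4) = 1 := by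
      rw [padicValNat.mul (by norm_num) (by norm_num), padicValNat.self (by norm_num),
        padicValNat.eq_zero_of_not_dvd (by norm_num)]
    have h4 : Even 4 := by decide
    have h1 := (stirlingSecond_sub_one_ratModEq_fleckSum (p := 37) (n := 4) (q := 0) (b := b)
      (m := m) (by decide) (by norm_num) h4 hm hb').trans fleckSum_thirtySeven_ratModEq_zero
    have h0 := (stirlingSecond_ratModEq_fleckSum (p := 37) (n := 4) (q := 0) (b := b)
      (m := m) (by norm_num) h4 hm hb').trans fleckSum_thirtySeven_ratModEq_zero
    have d1 : 37 ^ 6 ∣ (37 * 4 - 1).factorial *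
        Nat.stirlingSecond (m * Nat.totient (37 ^ b)) (37 * 4 - 1) := by
      have h := pow_succ_dvd_of_ratModEq (p := 37) (k := 5) (x := (((37 * 4 - 1).factorial *
        Nat.stirlingSecond (m * Nat.totient (37 ^ b)) (37 * 4 - 1) : ℕ) : ℤ)) (by
          have h := h1.mul_left (natCast_mem (pIntegralRat 37) 2)
          rw [mul_zero] at h
          convert h using 1
          rw [Int.cast_natCast, Nat.cast_mul]
          generalize (((37 * 4 - 1).factorial : ℕ) : ℚ) = F
          push_cast
          ring)
      exact_mod_cast h
    have d0 : 37 ^ 5 ∣ (37 * 4 - 1).factorial *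
        Nat.stirlingSecond (m * Nat.totient (37 ^ b)) (37 * 4) := by
      have h := pow_succ_dvd_of_ratModEq (p := 37) (k := 4) (x := (((37 * 4 - 1).factorial *
        Nat.stirlingSecond (m * Nat.totient (37 ^ b)) (37 * 4) : ℕ) : ℤ)) (by
          have h := h0.neg
          rw [neg_zero, neg_neg] at h
          convert h using 1
          rw [Int.cast_natCast, Nat.cast_mul]
          generalize (((37 * 4 - 1).factorial : ℕ) : ℚ) = F
          push_cast
          ring)
      exact_mod_cast h
    have d0' : 37 ^ 6 ∣ (37 * 4).factorial *
        Nat.stirlingSecond (m * Nat.totient (37 ^ b)) (37 * 4) := by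
      rw [← Nat.mul_factorial_pred (by norm_num : 37 * 4 ≠ 0), mul_assoc (37 * 4), pow_succ',
        mul_assoc 37 4]
      exact Nat.mul_dvd_mul_left 37 (d0.mul_left 4)
    rw [hv]
    exact ⟨lt_of_lt_of_le (Nat.cast_lt.2 (by norm_num)) (le_emultiplicity_of_pow_dvd d1),
      lt_of_lt_of_le (Nat.cast_lt.2 (by norm_num)) (le_emultiplicity_of_pow_dvd d0')⟩
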